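/- Let $N\ge 2$, let $\Omega\subset\mathbb R^N$ be open, and let $u\in C^{1,\alpha}(\Omega)\cap C^2(\Omega\setminus \mathcal Z_u)$, $0<\alpha<1$, where $\mathcal Z_u=\{x\in\Omega:\nabla u(x)=0\}$, be a weak solution of $$-\operatorname{div}(A(|\nabla u|)\nabla u)+B(|\nabla u|)=f(u)\quad\text{in }\Omega ,$$ that is, $\int_\Omega A(|\nabla u|)\langle\nabla u,\nabla\psi\rangle\,dx+\int_\Omega B(|\nabla u|)\psi\,dx=\int_\Omega f\psi\,dx$ for all $\psi\in C_c^\infty(\Omega)$, where $f(x)=f(u(x))$ denotes the right-hand side as a function on $\Omega$ and $f\in W^{1,\infty}(\Omega)$ (the result holds for any source term $f=f(x)$ in $W^{1,\infty}(\Omega)$). Assume that $A:(0,\infty)\to(0,\infty)$ is of class $C^1$ with $$\limsup_{t\to0^+}tA(t)<+\infty,\qquad -1<m_A:=\inf_{t>0}\frac{tA'(t)}{A(t)}\le M_A:=\sup_{t>0}\frac{tA'(t)}{A(t)}<+\infty ,$$ and that $B:[0,\infty)\to[0,\infty)$ is of class $C^1$ with $|B'(t)|\le\hat C\,tA(t)$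 for all $t>0$ and some $\hat C>0$. Let $x_0\in\Omega$ and $\rho>0$ be such that $B_{2\rho}(x_0)\subset\Omega$, and let $L,F,T\in\mathbb R$ be such that $|\nabla u|\le L$ in $B_{2\rho}(x_0)$, $|\nabla f|\le F$ a.e. in $B_{2\rho}(x_0)$, and $tA(t)\le T$ for $0<t\le L$. Let $0\le\beta<1$, and let $\gamma<N-2$ if $N\ge3$, $\gamma=0$ if $N=2$. Then, for every $y\in B_\rho(x_0)$ and every $i=1,\dots,N$, $$\int_{B_\rho(x_0)}\frac{A(|\nabla u|)\,|\nabla u_i|^2}{|x-y|^\gamma|u_i|^\beta}\,dx\le\mathcal C,$$ where $u_i=\partial u/\partial x_i$, the second derivatives of $u$ are set equal to $0$ on $\mathcal Z_u$, the integrand is $0$ where its numerator vanishes, and the constant $\mathcal C$ depends only on $N,\gamma,\beta,m_A,M_A,T,\hat C,F,L,\rho$ and $x_0$ (in particular not on $y$, $i$, $\Omega$, or otherwise on $u$). -/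

import Mathlib

open Set Filter Topology MeasureTheory
open scoped NNReal ENNReal ContDiff

noncomputable section

/-- Euclidean space `ℝ^N` (with the Euclidean norm and Lebesgue measure). -/
abbrev EucSp (N : ℕ) : Type := EuclideanSpace ℝ (Fin N)

/-- `ψ ∈ C_c^∞(Ω)`. -/
def IsTestFunction {N : ℕ} (Ω : Set (EucSp N)) (ψ : EucSp N → ℝ) : Prop :=
  ContDiff ℝ ∞ ψ ∧ HasCompactSupport ψ ∧ tsupport ψ ⊆ Ω

/-- `u ∈ C^{1,α}(Ω)`: `u` is of class `C¹` in the open set `Ω` and its gradient is `α`-Hölder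
continuous on every compact subset of `Ω`. -/
def MemC1Holder {N : ℕ} (Ω : Set (EucSp N)) (α : ℝ≥0) (u : EucSp N → ℝ) : Prop :=
  ContDiffOn ℝ 1 u Ω ∧
    ∀ K : Set (EucSp N), IsCompact K → K ⊆ Ω → ∃ C : ℝ≥0, HolderOnWith C α (gradient u) K

/-- The critical set `Z_u = {x ∈ Ω : ∇u(x) = 0}`. -/
def critSet {N : ℕ} (Ω : Set (EucSp N)) (u : EucSp N → ℝ) : Set (EucSp N) :=
  {x | x ∈ Ω ∧ gradient u x = 0}

open Classical in
/-- `∇u_i(x)`, the gradient of the `i`-th partial derivative `u_i` of `u`, with the convention that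
the second derivatives of `u` are `0` at the points where `∇u = 0`. -/
def gradPartial {N : ℕ} (u : EucSp N → ℝ) (i : Fin N) (x : EucSp N) : EucSp N :=
  if gradient u x = 0 then 0 else gradient (fun z => gradient u z i) x

/-- `g` is the weak (distributional) gradient of `f` in the open set `Ω`. -/
def IsWeakGradient {N : ℕ} (Ω : Set (EucSp N)) (f : EucSp N → ℝ) (g : EucSp N → EucSp N) : Prop :=
  LocallyIntegrableOn f Ω ∧ LocallyIntegrableOn g Ω ∧
    ∀ ψ : EucSp N → ℝ, IsTestFunction Ω ψ → ∀ i : Fin N,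
      ∫ x in Ω, f x * gradient ψ x i = - ∫ x in Ω, g x i * ψ x

/-- `f ∈ W^{1,∞}(Ω)`: `f` and its weak gradient in `Ω` belong to `L^∞(Ω)`. -/
def MemW1Infty {N : ℕ} (Ω : Set (EucSp N)) (f : EucSp N → ℝ) : Prop :=
  MemLp f ⊤ (volume.restrict Ω) ∧
    ∃ g : EucSp N → EucSp N, MemLp g ⊤ (volume.restrict Ω) ∧ IsWeakGradient Ω f g

/-- `u` satisfies `-div (A(|∇u|) ∇u) + B(|∇u|) = f` in `Ω` in the weak sense. Here `f` is the source
term as a function of the point; for a nonlinearity `F` of `u` it is `fun x => F (u x)`. -/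
def IsWeakSolution {N : ℕ} (Ω : Set (EucSp N)) (A B : ℝ → ℝ) (f u : EucSp N → ℝ) : Prop :=
  ∀ ψ : EucSp N → ℝ, IsTestFunction Ω ψ →
    (∫ x in Ω, A ‖gradient u x‖ * inner ℝ (gradient u x) (gradient ψ x))
      + (∫ x in Ω, B ‖gradient u x‖ * ψ x) = ∫ x in Ω, f x * ψ x

end

/-! ### Almost everywhere vanishing of derivatives on zero sets -/

section General

variable {E : Type*} [NormedAddCommGroup E] [NormedSpace ℝ E] [FiniteDimensional ℝ E]
  [MeasurableSpace E] [BorelSpace E]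

/-! Off the critical set `u` is `C²`, so the equation can be differentiated in `x_i` there
(`linearized`). The resulting linear equation for `u_i` is tested with `φ = u_i τ(u_i) ζ²`, where
`τ` is a smooth truncation of `|t|^(-β)` that vanishes for `t² ≤ κ`. As `u_i = 0` on `Z_u`, this `φ`
is supported away from `Z_u`.

The principal term is coercive for two reasons: `m > -1` makes the linearized operator elliptic with
weight `A(|∇u|)` (`le_inner_fluxDeriv`), and `β < 1` makes `(1 - β) τ(t)`, a lower bound for `(t
τ(t))'`, a positive multiple of `τ(t)` wherever `τ(t) > 0` (`le_deriv_mul_truncPow`). Young's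
inequality absorbs the remaining terms, because `A(|∇u|) u_i² τ(u_i) ≤ T L^(1-β)` uniformly in `κ`.
Hence `∫ A |∇u_i|² τ(u_i) ζ²` is at most a constant times `∫ (ζ² + |∇ζ|²)` (`energy_estimate`).

Now take `ζ² = (|x-y|² + δ)^(-γ/2) η²` with a fixed cutoff `η`. Then `|∇ζ|²` is of order at most
`|x-y|^(-γ-2)` near `y`, which is integrable exactly because `γ + 2 < N`; for `γ = 0` this singular
term is absent. The bound is uniform in `y` and `δ` (`exists_weighted_cutoff`). Letting `κ = δ → 0`,
Fatou's lemma gives the claim, since `∇u_i = 0` almost everywhere on `{u_i = 0}`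
(`ae_gradPartial_eq_zero`). -/

theorem countable_zeros_of_deriv_ne_zero (h : ℝ → ℝ) :
    {t | h t = 0 ∧ deriv h t ≠ 0}.Countable := by
  -- A zero at which the derivative does not vanish is isolated, and the points of a set of reals
  -- that are isolated from the right form a countable set.
  refine (countable_setOfPred_isolated_right_within
    (s := {t | h t = 0 ∧ deriv h t ≠ 0})).mono ?_
  rintro t ⟨ht, hd⟩
  have hne : ∀ᶠ z in 𝓝[≠] t, h z ≠ 0 :=
    (differentiableAt_of_deriv_ne_zero hd).hasDerivAt.eventually_ne hd
  have h1 : ∀ᶠ z in 𝓝[>] t, h z ≠ 0 :=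
    hne.filter_mono (nhdsWithin_mono _ fun z hz => ne_of_gt hz)
  refine ⟨⟨ht, hd⟩, ?_⟩
  rw [inter_comm, nhdsWithin_inter', ← Filter.empty_mem_iff_bot]
  filter_upwards [Filter.mem_inf_of_left h1, Filter.mem_inf_of_right (Filter.mem_principal_self _)]
    with z hz hz'
  exact hz hz'.1

/-- Fubini along the lines in direction `v`: on each line the exceptional points are countable. No
regularity of `g` is needed, since `fderiv` is `0` where `g` is not differentiable. -/
theorem ae_fderiv_eq_zero_of_eq_zero (μ : Measure E) [μ.IsAddHaarMeasure] {g : E → ℝ}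
    (hg : Measurable g) (v : E) : ∀ᵐ x ∂μ, g x = 0 → fderiv ℝ g x v = 0 := by
  have hm : MeasurableSet {x | g x = 0 → fderiv ℝ g x v = 0} := by
    have h1 : MeasurableSet {x | g x = 0} := hg (measurableSet_singleton 0)
    have h2 : MeasurableSet {x | fderiv ℝ g x v = 0} :=
      (measurable_fderiv_apply_const ℝ g v) (measurableSet_singleton 0)
    exact h1.imp h2
  refine ae_mem_of_ae_add_linearMap_mem (LinearMap.toSpanSingleton ℝ E v) volume μ hm fun y => ?_
  have hc := countable_zeros_of_deriv_ne_zero fun t : ℝ => g (y + t • v)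
  filter_upwards [hc.ae_notMem volume] with t ht h0
  by_contra hd
  simp only [LinearMap.toSpanSingleton_apply] at h0 hd
  refine ht ⟨h0, ?_⟩
  have hdiff : DifferentiableAt ℝ g (y + t • v) := by
    by_contra hn
    simp [fderiv_zero_of_not_differentiableAt hn] at hd
  have hl : HasDerivAt (fun t : ℝ => y + t • v) v t := by
    simpa using ((hasDerivAt_id t).smul_const v).const_add y
  have := hdiff.hasFDerivAt.comp_hasDerivAt t hl
  exact fun h => hd (this.deriv.symm.trans h)

theorem integrable_of_continuousOn_of_support_subset {F : Type*} [NormedAddCommGroup F]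
    {μ : Measure E} [IsLocallyFiniteMeasure μ]
    {f : E → F} {K : Set E} (hK : IsCompact K) (hf : ContinuousOn f K)
    (hs : Function.support f ⊆ K) : Integrable f μ :=
  (integrableOn_iff_integrable_of_support_subset hs).1 (hf.integrableOn_compact hK)

end General

/-! ### From smooth to `C¹` test functions -/

section WeakIdentity

variable {N : ℕ}

/-- Mollification. The common compact set and the bounds uniform in `n` are what dominated
convergence will need. -/
theorem exists_isTestFunction_approx {U : Set (EucSp N)} (hU : IsOpen U) {φ : EucSp N → ℝ}
    (hφ : ContDiff ℝ 1 φ) (hc : HasCompactSupport φ) (hs : tsupport φ ⊆ U) :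
    ∃ (K : Set (EucSp N)) (C : ℝ) (ψ : ℕ → EucSp N → ℝ), IsCompact K ∧ K ⊆ U ∧
      (∀ n, IsTestFunction U (ψ n)) ∧ (∀ n, Function.support (ψ n) ⊆ K) ∧
      (∀ n x, |ψ n x| ≤ C) ∧ (∀ n x v, |fderiv ℝ (ψ n) x v| ≤ C * ‖v‖) ∧
      (∀ x, Tendsto (fun n => ψ n x) atTop (𝓝 (φ x))) ∧
      ∀ x v, Tendsto (fun n => fderiv ℝ (ψ n) x v) atTop (𝓝 (fderiv ℝ φ x v)) := by
  obtain ⟨δ, hδ, hδU⟩ := hc.isCompact.exists_cthickening_subset_open hU hs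
  obtain ⟨C₀, hC₀⟩ := hc.exists_bound_of_continuous hφ.continuous
  obtain ⟨C₁, hC₁⟩ := (hc.fderiv (𝕜 := ℝ)).exists_bound_of_continuous
    (hφ.continuous_fderiv one_ne_zero)
  have hr (n : ℕ) : 0 < δ / ((n : ℝ) + 1) := by positivity
  let b (n : ℕ) : ContDiffBump (0 : EucSp N) :=
    ⟨δ / ((n : ℝ) + 1) / 2, δ / ((n : ℝ) + 1), half_pos (hr n), half_lt_self (hr n)⟩
  have hb0 : Tendsto (fun n => (b n).rOut) atTop (𝓝 0) :=
    tendsto_const_div_atTop_nhds_zero_nat δ |>.comp (tendsto_add_atTop_nat 1) |>.congr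
      fun n => by simp [b]
  let ψ (n : ℕ) : EucSp N → ℝ :=
    convolution ((b n).normed volume) φ (ContinuousLinearMap.lsmul ℝ ℝ) volume
  have hloc (n : ℕ) : LocallyIntegrable ((b n).normed volume) volume :=
    ((b n).continuous_normed (μ := volume)).locallyIntegrable
  -- The derivative is put on `φ`, not on the bump, so that it stays bounded as the bump shrinks.
  have hfd (n : ℕ) (x v : EucSp N) : fderiv ℝ (ψ n) x v =
      convolution ((b n).normed volume) (fun a => fderiv ℝ φ a v)
        (ContinuousLinearMap.lsmul ℝ ℝ) volume x := by
    rw [(hc.hasFDerivAt_convolution_right (ContinuousLinearMap.lsmul ℝ ℝ) (hloc n) hφ x).fderiv]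
    exact convolution_precompR_apply _ (hloc n) (hc.fderiv (𝕜 := ℝ))
      (hφ.continuous_fderiv one_ne_zero) x v
  have hfc (v : EucSp N) : Continuous fun a => fderiv ℝ φ a v :=
    (hφ.continuous_fderiv one_ne_zero).clm_apply continuous_const
  have hK : IsCompact (Metric.cthickening δ (tsupport φ)) := hc.isCompact.cthickening
  have hsupp (n : ℕ) : Function.support (ψ n) ⊆ Metric.cthickening δ (tsupport φ) := by
    refine (support_convolution_subset _).trans ?_
    rw [(b n).support_normed_eq]
    rintro _ ⟨p, hp, q, hq, rfl⟩
    refine Metric.mem_cthickening_of_dist_le _ q _ _ (subset_tsupport _ hq) ?_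
    have hp' : ‖p‖ < δ / ((n : ℝ) + 1) := by simpa [b] using hp
    have : δ / ((n : ℝ) + 1) ≤ δ := div_le_self hδ.le (by simp)
    simpa [dist_eq_norm] using (hp'.trans_le this).le
  have hts (n : ℕ) : tsupport (ψ n) ⊆ Metric.cthickening δ (tsupport φ) :=
    closure_minimal (hsupp n) hK.isClosed
  -- The average differs from `g x` by at most the oscillation `2c`, whence `3c`.
  have hbound {g : EucSp N → ℝ} (hg : Continuous g) {c : ℝ} (hgc : ∀ x, |g x| ≤ c) (n : ℕ)
      (x : EucSp N) : |convolution ((b n).normed volume) g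
        (ContinuousLinearMap.lsmul ℝ ℝ) volume x| ≤ 3 * c := by
    have h1 := (b n).dist_normed_convolution_le (μ := volume) (x₀ := x) (ε := 2 * c)
      hg.aestronglyMeasurable fun y _ => by
        rw [Real.dist_eq]
        linarith [abs_sub (g y) (g x), hgc x, hgc y]
    rw [Real.dist_eq] at h1
    linarith [abs_sub_abs_le_abs_sub
      (convolution ((b n).normed volume) g (ContinuousLinearMap.lsmul ℝ ℝ) volume x) (g x), hgc x]
  refine ⟨Metric.cthickening δ (tsupport φ), max (3 * C₀) (3 * C₁), ψ, hK, hδU, fun n => ⟨?_, ?_, ?_⟩,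
    hsupp, fun n x => ?_, fun n x v => ?_, fun x => ?_, fun x v => ?_⟩
  · exact (b n).hasCompactSupport_normed.contDiff_convolution_left _ (b n).contDiff_normed
      hφ.continuous.locallyIntegrable
  · exact hK.of_isClosed_subset (isClosed_tsupport _) (hts n)
  · exact (hts n).trans hδU
  · exact (hbound hφ.continuous (fun x => hC₀ x) n x).trans (le_max_left _ _)
  · rw [hfd]
    refine (hbound (hfc v) (c := C₁ * ‖v‖) (fun x => ?_) n x).trans ?_
    · exact (fderiv ℝ φ x).le_of_opNorm_le (hC₁ x) v
    · rw [← mul_assoc]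
      exact mul_le_mul_of_nonneg_right (le_max_right _ _) (norm_nonneg v)
  · exact ContDiffBump.convolution_tendsto_right_of_continuous hb0 hφ.continuous x
  · simp_rw [hfd]
    exact ContDiffBump.convolution_tendsto_right_of_continuous hb0 (hfc v) x

/-- Needed because the test function built from `u_i` is only `C¹`, `u` being only `C²` off `Z_u`.
Dominated convergence along the mollifications suffices for locally integrable coefficients. -/
theorem integrable_and_integral_eq_zero_of_forall_isTestFunction {U : Set (EucSp N)} (hU : IsOpen U)
    {W : EucSp N → EucSp N} {w : EucSp N → ℝ} (hW : LocallyIntegrableOn W U)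
    (hw : LocallyIntegrableOn w U)
    (h : ∀ ψ, IsTestFunction U ψ → ∫ x, (fderiv ℝ ψ x (W x) + w x * ψ x) = 0)
    {φ : EucSp N → ℝ} (hφ : ContDiff ℝ 1 φ) (hc : HasCompactSupport φ) (hs : tsupport φ ⊆ U) :
    Integrable (fun x => fderiv ℝ φ x (W x) + w x * φ x) ∧
      ∫ x, (fderiv ℝ φ x (W x) + w x * φ x) = 0 := by
  obtain ⟨K, C, ψ, hK, hKU, hψ, hsupp, hψC, hdC, hlim, hdlim⟩ :=
    exists_isTestFunction_approx hU hφ hc hs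
  have hWK : IntegrableOn W K := hW.integrableOn_compact_subset hKU hK
  have hwK : IntegrableOn w K := hw.integrableOn_compact_subset hKU hK
  have hψ0 (n : ℕ) (x : EucSp N) (hx : x ∉ K) : ψ n x = 0 := by
    by_contra hne
    exact hx (hsupp n hne)
  have hd0 (n : ℕ) (x : EucSp N) (hx : x ∉ K) : fderiv ℝ (ψ n) x = 0 := by
    by_contra hne
    exact hx (closure_minimal (hsupp n) hK.isClosed
      (support_fderiv_subset ℝ (Function.mem_support.2 hne)))
  have hF0 (n : ℕ) (x : EucSp N) (hx : x ∉ K) :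
      fderiv ℝ (ψ n) x (W x) + w x * ψ n x = 0 := by
    simp [hψ0 n x hx, hd0 n x hx]
  have hF0' (x : EucSp N) (hx : x ∉ K) : fderiv ℝ φ x (W x) + w x * φ x = 0 := by
    have h1 := tendsto_nhds_unique (hlim x)
      (tendsto_const_nhds.congr fun n => (hψ0 n x hx).symm)
    have h2 := tendsto_nhds_unique (hdlim x (W x))
      (tendsto_const_nhds.congr fun n => by rw [hd0 n x hx])
    rw [h1, h2]
    simp
  have hbd : IntegrableOn (fun x => C * ‖W x‖ + ‖w x‖ * C) K :=
    (hWK.norm.const_mul C).add (hwK.norm.mul_const C)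
  have hmeas {χ : EucSp N → ℝ} (hχ : ContDiff ℝ 1 χ) :
      AEStronglyMeasurable (fun x => fderiv ℝ χ x (W x) + w x * χ x) (volume.restrict K) :=
    (isBoundedBilinearMap_apply.continuous.comp_aestronglyMeasurable
      ((hχ.continuous_fderiv one_ne_zero).aestronglyMeasurable.prodMk hWK.1)).add
      (hwK.1.mul hχ.continuous.aestronglyMeasurable)
  have hlim' (x : EucSp N) : Tendsto (fun n => fderiv ℝ (ψ n) x (W x) + w x * ψ n x) atTop
      (𝓝 (fderiv ℝ φ x (W x) + w x * φ x)) := (hdlim x (W x)).add ((hlim x).const_mul (w x))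
  have hle (n : ℕ) (x : EucSp N) :
      ‖fderiv ℝ (ψ n) x (W x) + w x * ψ n x‖ ≤ C * ‖W x‖ + ‖w x‖ * C := by
    refine (norm_add_le _ _).trans (add_le_add (hdC n x _) ?_)
    rw [norm_mul]
    exact mul_le_mul_of_nonneg_left (hψC n x) (norm_nonneg _)
  refine ⟨(integrableOn_iff_integrable_of_support_subset fun x hx => ?_).1 (hbd.mono' (hmeas hφ)
    (Eventually.of_forall fun x => le_of_tendsto' (hlim' x).norm fun n => hle n x)), ?_⟩
  · by_contra hn
    exact hx (hF0' x hn)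
  rw [← setIntegral_eq_integral_of_forall_compl_eq_zero hF0']
  have hz (n : ℕ) : ∫ x in K, (fderiv ℝ (ψ n) x (W x) + w x * ψ n x) = 0 := by
    rw [setIntegral_eq_integral_of_forall_compl_eq_zero (hF0 n), h _ (hψ n)]
  suffices key : Tendsto (fun n => ∫ x in K, (fderiv ℝ (ψ n) x (W x) + w x * ψ n x)) atTop
      (𝓝 (∫ x in K, (fderiv ℝ φ x (W x) + w x * φ x))) from
    tendsto_nhds_unique key (tendsto_const_nhds.congr fun n => (hz n).symm)
  exact tendsto_integral_of_dominated_convergence _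
    (fun n => hmeas ((hψ n).1.of_le (by simp))) hbd
    (fun n => Eventually.of_forall (hle n)) (Eventually.of_forall hlim')

end WeakIdentity

/-! ### Gradient and Hessian of `u` -/

section Gradient

variable {N : ℕ} {u : EucSp N → ℝ}

theorem gradient_eq_toDual_symm (u : EucSp N → ℝ) (x : EucSp N) :
    gradient u x = (InnerProductSpace.toDual ℝ (EucSp N)).symm (fderiv ℝ u x) := rfl

theorem inner_gradient_eq_fderiv (u : EucSp N → ℝ) (x v : EucSp N) :
    inner ℝ (gradient u x) v = fderiv ℝ u x v := by
  rw [gradient_eq_toDual_symm, InnerProductSpace.toDual_symm_apply]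

theorem contDiffOn_gradient {U : Set (EucSp N)} (hU : IsOpen U) (hu : ContDiffOn ℝ 2 u U) :
    ContDiffOn ℝ 1 (gradient u) U :=
  ((InnerProductSpace.toDual ℝ (EucSp N)).symm.contDiff (n := 1)).comp_contDiffOn
    (hu.fderiv_of_isOpen hU (by norm_num))

theorem continuousOn_gradient {U : Set (EucSp N)} (hU : IsOpen U) (hu : ContDiffOn ℝ 1 u U) :
    ContinuousOn (gradient u) U :=
  (InnerProductSpace.toDual ℝ (EucSp N)).symm.continuous.comp_continuousOn
    (hu.continuousOn_fderiv_of_isOpen hU le_rfl)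

theorem measurable_gradient (u : EucSp N → ℝ) : Measurable (gradient u) :=
  (InnerProductSpace.toDual ℝ (EucSp N)).symm.continuous.measurable.comp (measurable_fderiv ℝ u)

theorem inner_fderiv_gradient_eq {x : EucSp N} (hu : ContDiffAt ℝ 2 u x) (v w : EucSp N) :
    inner ℝ (fderiv ℝ (gradient u) x v) w = fderiv ℝ (fderiv ℝ u) x v w := by
  have hd : DifferentiableAt ℝ (fderiv ℝ u) x :=
    (hu.fderiv_right (m := 1) (by norm_num)).differentiableAt one_ne_zero
  have h := ((InnerProductSpace.toDual ℝ (EucSp N)).symm.toContinuousLinearEquiv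
    |>.toContinuousLinearMap.hasFDerivAt.comp x hd.hasFDerivAt).fderiv
  have h' : fderiv ℝ (gradient u) x v =
      (InnerProductSpace.toDual ℝ (EucSp N)).symm (fderiv ℝ (fderiv ℝ u) x v) :=
    congrArg (fun l => l v) h
  rw [h', InnerProductSpace.toDual_symm_apply]

theorem inner_fderiv_gradient_comm {x : EucSp N} (hu : ContDiffAt ℝ 2 u x) (v w : EucSp N) :
    inner ℝ (fderiv ℝ (gradient u) x v) w = inner ℝ (fderiv ℝ (gradient u) x w) v := by
  rw [inner_fderiv_gradient_eq hu, inner_fderiv_gradient_eq hu]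
  exact (hu.isSymmSndFDerivAt (by simp)).eq v w

/-- Symmetry of the Hessian: `∇u_i = ∂_i ∇u`. -/
theorem hasFDerivAt_gradient_apply {x : EucSp N} (hu : ContDiffAt ℝ 2 u x) (i : Fin N) :
    HasFDerivAt (fun z => gradient u z i)
      (innerSL ℝ (fderiv ℝ (gradient u) x (EuclideanSpace.single i 1))) x := by
  have hd : DifferentiableAt ℝ (gradient u) x :=
    (((InnerProductSpace.toDual ℝ (EucSp N)).symm.contDiff (n := 1)).contDiffAt.comp x
      (hu.fderiv_right (m := 1) (by norm_num))).differentiableAt one_ne_zero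
  have h := (EuclideanSpace.proj (𝕜 := ℝ) i).hasFDerivAt.comp x hd.hasFDerivAt
  refine h.congr_fderiv (ContinuousLinearMap.ext fun w => ?_)
  rw [innerSL_apply_apply, inner_fderiv_gradient_comm hu, EuclideanSpace.inner_single_right]
  simp

theorem gradPartial_eq {x : EucSp N} (hu : ContDiffAt ℝ 2 u x) (hx : gradient u x ≠ 0)
    (i : Fin N) :
    gradPartial u i x = fderiv ℝ (gradient u) x (EuclideanSpace.single i 1) := by
  rw [gradPartial, if_neg hx, gradient_eq_toDual_symm, (hasFDerivAt_gradient_apply hu i).fderiv]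
  exact (InnerProductSpace.toDual ℝ (EucSp N)).symm_apply_apply _

theorem abs_gradient_apply_le (u : EucSp N → ℝ) (x : EucSp N) (i : Fin N) :
    |gradient u x i| ≤ ‖gradient u x‖ :=
  PiLp.norm_apply_le (gradient u x) i

theorem isOpen_diff_critSet {Ω : Set (EucSp N)} (hΩ : IsOpen Ω) (hu : ContDiffOn ℝ 1 u Ω) :
    IsOpen (Ω \ critSet Ω u) := by
  have h := (continuousOn_gradient hΩ hu).isOpen_inter_preimage hΩ isOpen_compl_singleton
    (t := {(0 : EucSp N)}ᶜ)
  convert h using 1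
  ext x
  simp only [critSet, Set.mem_sdiff, mem_ofPred_eq, mem_inter_iff, mem_preimage, mem_compl_iff,
    mem_singleton_iff]
  tauto

end Gradient

/-! ### The differentiated equation off the critical set -/

section Linearized

variable {N : ℕ} {Ω : Set (EucSp N)} {A B : ℝ → ℝ} {f u : EucSp N → ℝ} {Df : EucSp N → EucSp N}

/-- The derivative in the direction `v` of the vector field `A(|∇u|) ∇u`, where `G = ∇u` and
`h = ∂_v ∇u`. -/
noncomputable def fluxDeriv (A : ℝ → ℝ) (G h : EucSp N) : EucSp N :=
  A ‖G‖ • h + (deriv A ‖G‖ * (inner ℝ G h / ‖G‖)) • G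

theorem hasFDerivAt_norm_comp {G : EucSp N → EucSp N} {G' : EucSp N →L[ℝ] EucSp N} {x : EucSp N}
    (hG : HasFDerivAt G G' x) (hx : G x ≠ 0) :
    HasFDerivAt (fun z => ‖G z‖) ((1 / ‖G x‖) • (innerSL ℝ (G x)).comp G') x := by
  have h1 := (hG.norm_sq).sqrt (by simpa using hx)
  simp only [Real.sqrt_sq (norm_nonneg _)] at h1
  refine h1.congr_fderiv (ContinuousLinearMap.ext fun w => ?_)
  simp
  field_simp

theorem fderiv_flux {G : EucSp N → EucSp N} {x : EucSp N} (hG : DifferentiableAt ℝ G x)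
    (hx : G x ≠ 0) (hA : DifferentiableAt ℝ A ‖G x‖) (v : EucSp N) :
    fderiv ℝ (fun z => A ‖G z‖ • G z) x v = fluxDeriv A (G x) (fderiv ℝ G x v) := by
  have h1 := hA.hasDerivAt.comp_hasFDerivAt x (hasFDerivAt_norm_comp hG.hasFDerivAt hx)
  have h2 := (h1.smul hG.hasFDerivAt).fderiv
  have h3 : fderiv ℝ (fun z => A ‖G z‖ • G z) x v = _ := congrArg (fun l => l v) h2
  rw [h3]
  simp [fluxDeriv]
  ring_nf

theorem fderiv_comp_norm {G : EucSp N → EucSp N} {x : EucSp N} (hG : DifferentiableAt ℝ G x)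
    (hx : G x ≠ 0) (hB : DifferentiableAt ℝ B ‖G x‖) (v : EucSp N) :
    fderiv ℝ (fun z => B ‖G z‖) x v = deriv B ‖G x‖ * (inner ℝ (G x) (fderiv ℝ G x v) / ‖G x‖) := by
  have h1 := (hB.hasDerivAt.comp_hasFDerivAt x (hasFDerivAt_norm_comp hG.hasFDerivAt hx)).fderiv
  have h3 : fderiv ℝ (fun z => B ‖G z‖) x v = _ := congrArg (fun l => l v) h1
  rw [h3]
  simp only [smul_apply, ContinuousLinearMap.comp_apply, innerSL_apply_apply, smul_eq_mul]
  ring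

theorem contDiffOn_norm_gradient_comp {U : Set (EucSp N)} (hU : IsOpen U)
    (hu : ContDiffOn ℝ 2 u U) (h0 : ∀ x ∈ U, gradient u x ≠ 0) {s : Set ℝ} (hs : Ioi 0 ⊆ s)
    (hA : ContDiffOn ℝ 1 A s) : ContDiffOn ℝ 1 (fun x => A ‖gradient u x‖) U :=
  hA.comp ((contDiffOn_gradient hU hu).norm ℝ h0) fun x hx => hs (norm_pos_iff.2 (h0 x hx))

theorem continuousOn_gradPartial {U : Set (EucSp N)} (hU : IsOpen U) (hu : ContDiffOn ℝ 2 u U)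
    (h0 : ∀ x ∈ U, gradient u x ≠ 0) (i : Fin N) : ContinuousOn (gradPartial u i) U :=
  (((contDiffOn_gradient hU hu).continuousOn_fderiv_of_isOpen hU le_rfl).clm_apply
    continuousOn_const).congr fun x hx =>
      gradPartial_eq (hu.contDiffAt (hU.mem_nhds hx)) (h0 x hx) i

theorem fderiv_flux_gradient {U : Set (EucSp N)} (hU : IsOpen U)
    (hu : ContDiffOn ℝ 2 u U) (h0 : ∀ x ∈ U, gradient u x ≠ 0) (hA : ContDiffOn ℝ 1 A (Ioi 0))
    (i : Fin N) {x : EucSp N} (hx : x ∈ U) :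
    fderiv ℝ (fun z => A ‖gradient u z‖ • gradient u z) x (EuclideanSpace.single i 1) =
      fluxDeriv A (gradient u x) (gradPartial u i x) := by
  rw [fderiv_flux (((contDiffOn_gradient hU hu).contDiffAt (hU.mem_nhds hx)).differentiableAt
    one_ne_zero) (h0 x hx) ((hA.contDiffAt (Ioi_mem_nhds (norm_pos_iff.2 (h0 x hx)))
    ).differentiableAt one_ne_zero), gradPartial_eq (hu.contDiffAt (hU.mem_nhds hx)) (h0 x hx)]

theorem fderiv_comp_norm_gradient {U : Set (EucSp N)} (hU : IsOpen U)
    (hu : ContDiffOn ℝ 2 u U) (h0 : ∀ x ∈ U, gradient u x ≠ 0) (hB : ContDiffOn ℝ 1 B (Ici 0))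
    (i : Fin N) {x : EucSp N} (hx : x ∈ U) :
    fderiv ℝ (fun z => B ‖gradient u z‖) x (EuclideanSpace.single i 1) =
      deriv B ‖gradient u x‖ *
        (inner ℝ (gradient u x) (gradPartial u i x) / ‖gradient u x‖) := by
  rw [fderiv_comp_norm (((contDiffOn_gradient hU hu).contDiffAt (hU.mem_nhds hx)).differentiableAt
    one_ne_zero) (h0 x hx) ((hB.contDiffAt (Ici_mem_nhds (norm_pos_iff.2 (h0 x hx)))
    ).differentiableAt one_ne_zero), gradPartial_eq (hu.contDiffAt (hU.mem_nhds hx)) (h0 x hx)]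

/-- Integration by parts against a test function, for a vector field of class `C¹` near the
support of the test function. -/
theorem integral_fderiv_fderiv_eq_neg {U : Set (EucSp N)} (hU : IsOpen U)
    {V : EucSp N → EucSp N} (hV : ContDiffOn ℝ 1 V U) {ψ : EucSp N → ℝ} (hψ : IsTestFunction U ψ)
    (e : EucSp N) :
    Integrable (fun x => fderiv ℝ ψ x (fderiv ℝ V x e)) ∧
    ∫ x, fderiv ℝ (fderiv ℝ ψ) x e (V x) = - ∫ x, fderiv ℝ ψ x (fderiv ℝ V x e) := by
  obtain ⟨hψ1, hψ2, hψ3⟩ := hψ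
  have hd : ContDiff ℝ 1 (fderiv ℝ ψ) := hψ1.fderiv_right (m := 1) (by norm_cast)
  have hd0 (x) (hx : x ∉ tsupport ψ) : fderiv ℝ ψ x = 0 := fderiv_of_notMem_tsupport ℝ hx
  have hdd0 (x) (hx : x ∉ tsupport ψ) : fderiv ℝ (fderiv ℝ ψ) x = 0 :=
    fderiv_of_notMem_tsupport ℝ fun h => hx (tsupport_fderiv_subset ℝ h)
  have hVc := hV.continuousOn.mono hψ3
  have hV'c := (hV.continuousOn_fderiv_of_isOpen hU le_rfl).mono hψ3
  have i1 : Integrable (fun x => fderiv ℝ ψ x (fderiv ℝ V x e)) := by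
    refine integrable_of_continuousOn_of_support_subset hψ2.isCompact
      (hd.continuous.continuousOn.clm_apply (hV'c.clm_apply continuousOn_const)) fun x hx => ?_
    by_contra hn
    exact hx (by simp [hd0 x hn])
  have i2 : Integrable (fun x => fderiv ℝ (fderiv ℝ ψ) x e (V x)) := by
    refine integrable_of_continuousOn_of_support_subset hψ2.isCompact
      ((((hd.continuous_fderiv one_ne_zero).clm_apply continuous_const).continuousOn).clm_apply
        hVc) fun x hx => ?_
    by_contra hn
    exact hx (by simp [hdd0 x hn])
  have i3 : Integrable (fun x => fderiv ℝ ψ x (V x)) := by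
    refine integrable_of_continuousOn_of_support_subset hψ2.isCompact
      (hd.continuous.continuousOn.clm_apply hVc) fun x hx => ?_
    by_contra hn
    exact hx (by simp [hd0 x hn])
  exact ⟨i1, integral_bilinear_hasFDerivAt_right_eq_neg_left_of_integrable (μ := volume)
    (B := ContinuousLinearMap.apply ℝ ℝ) (f := V) (f' := fderiv ℝ V) (g := fderiv ℝ ψ)
    (g' := fderiv ℝ (fderiv ℝ ψ)) (v := e) i1 i2 i3
    (fun x hx => ((hV.contDiffAt (hU.mem_nhds (hψ3 (tsupport_fderiv_subset ℝ hx)))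
      ).differentiableAt one_ne_zero).hasFDerivAt)
    (fun x _ => (hd.differentiable one_ne_zero x).hasFDerivAt)⟩

theorem integral_mul_fderiv_eq_neg {U : Set (EucSp N)} (hU : IsOpen U)
    {b : EucSp N → ℝ} (hb : ContDiffOn ℝ 1 b U) {ψ : EucSp N → ℝ} (hψ : IsTestFunction U ψ)
    (e : EucSp N) :
    Integrable (fun x => fderiv ℝ b x e * ψ x) ∧
    ∫ x, b x * fderiv ℝ ψ x e = - ∫ x, fderiv ℝ b x e * ψ x := by
  obtain ⟨hψ1, hψ2, hψ3⟩ := hψ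
  have hd : Continuous (fderiv ℝ ψ) := hψ1.continuous_fderiv (by simp)
  have hd0 (x) (hx : x ∉ tsupport ψ) : fderiv ℝ ψ x = 0 := fderiv_of_notMem_tsupport ℝ hx
  have h0 (x) (hx : x ∉ tsupport ψ) : ψ x = 0 := image_eq_zero_of_notMem_tsupport hx
  have hbc := hb.continuousOn.mono hψ3
  have hb'c := (hb.continuousOn_fderiv_of_isOpen hU le_rfl).mono hψ3
  have i1 : Integrable (fun x => fderiv ℝ b x e * ψ x) := by
    refine integrable_of_continuousOn_of_support_subset hψ2.isCompact
      ((hb'c.clm_apply continuousOn_const).mul hψ1.continuous.continuousOn) fun x hx => ?_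
    by_contra hn
    exact hx (by simp [h0 x hn])
  have i2 : Integrable (fun x => b x * fderiv ℝ ψ x e) := by
    refine integrable_of_continuousOn_of_support_subset hψ2.isCompact
      (hbc.mul (hd.clm_apply continuous_const).continuousOn) fun x hx => ?_
    by_contra hn
    exact hx (by simp [hd0 x hn])
  have i3 : Integrable (fun x => b x * ψ x) := by
    refine integrable_of_continuousOn_of_support_subset hψ2.isCompact
      (hbc.mul hψ1.continuous.continuousOn) fun x hx => ?_
    by_contra hn
    exact hx (by simp [h0 x hn])
  exact ⟨i1, integral_bilinear_hasFDerivAt_right_eq_neg_left_of_integrable (μ := volume)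
    (B := ContinuousLinearMap.mul ℝ ℝ) (f := b) (f' := fderiv ℝ b) (g := ψ)
    (g' := fderiv ℝ ψ) (v := e) i1 i2 i3
    (fun x hx => ((hb.contDiffAt (hU.mem_nhds (hψ3 hx))).differentiableAt one_ne_zero).hasFDerivAt)
    (fun x _ => (hψ1.differentiable (by simp) x).hasFDerivAt)⟩

/-- The `i`-th partial derivative of the equation, tested with `ψ ∈ C_c^∞(Ω ∖ Z_u)`. -/
theorem linearized_of_isTestFunction (hΩ : IsOpen Ω) (hA : ContDiffOn ℝ 1 A (Ioi 0))
    (hB : ContDiffOn ℝ 1 B (Ici 0)) (hDf : IsWeakGradient Ω f Df) (hu1 : ContDiffOn ℝ 1 u Ω)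
    (hu2 : ContDiffOn ℝ 2 u (Ω \ critSet Ω u)) (hsol : IsWeakSolution Ω A B f u) (i : Fin N)
    {ψ : EucSp N → ℝ} (hψ : IsTestFunction (Ω \ critSet Ω u) ψ) :
    ∫ x, (fderiv ℝ ψ x (fluxDeriv A (gradient u x) (gradPartial u i x)) +
      (deriv B ‖gradient u x‖ * (inner ℝ (gradient u x) (gradPartial u i x) / ‖gradient u x‖)
        - Df x i) * ψ x) = 0 := by
  have hU : IsOpen (Ω \ critSet Ω u) := isOpen_diff_critSet hΩ hu1
  have h0 : ∀ x ∈ Ω \ critSet Ω u, gradient u x ≠ 0 := fun x hx h => hx.2 ⟨hx.1, h⟩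
  have hψ' := hψ
  obtain ⟨hψ1, hψ2, hψ3⟩ := hψ'
  set e : EucSp N := EuclideanSpace.single i 1 with he
  have hVU : ContDiffOn ℝ 1 (fun z => A ‖gradient u z‖ • gradient u z) (Ω \ critSet Ω u) :=
    (contDiffOn_norm_gradient_comp hU hu2 h0 Subset.rfl hA).smul (contDiffOn_gradient hU hu2)
  have hBU : ContDiffOn ℝ 1 (fun z => B ‖gradient u z‖) (Ω \ critSet Ω u) :=
    contDiffOn_norm_gradient_comp hU hu2 h0 Ioi_subset_Ici_self hB
  obtain ⟨iV, eV⟩ := integral_fderiv_fderiv_eq_neg hU hVU hψ e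
  obtain ⟨iB, eB⟩ := integral_mul_fderiv_eq_neg hU hBU hψ e
  have hψΩ : IsTestFunction Ω ψ := ⟨hψ1, hψ2, hψ3.trans sdiff_subset⟩
  -- The equation is tested with `∂_i ψ`; integration by parts then moves `∂_i` onto the flux, onto
  -- `B(|∇u|)` and, through the weak gradient, onto `f`.
  have hψe : IsTestFunction Ω (fun x => fderiv ℝ ψ x e) :=
    ⟨(hψ1.fderiv_right (m := ∞) (by norm_cast)).clm_apply contDiff_const,
      hψ2.fderiv_apply (𝕜 := ℝ) e,
      (tsupport_fderiv_apply_subset ℝ e).trans hψΩ.2.2⟩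
  have hd0 (x) (hx : x ∉ Ω) : fderiv ℝ ψ x = 0 :=
    fderiv_of_notMem_tsupport ℝ fun h => hx (hψΩ.2.2 h)
  have hdd0 (x) (hx : x ∉ Ω) : fderiv ℝ (fun z => fderiv ℝ ψ z e) x = 0 :=
    fderiv_of_notMem_tsupport ℝ fun h => hx (hψe.2.2 h)
  have h00 (x) (hx : x ∉ Ω) : ψ x = 0 :=
    image_eq_zero_of_notMem_tsupport fun h => hx (hψΩ.2.2 h)
  -- Second derivatives of `ψ` commute, so `∂_i` becomes the outer derivative, ready for integration
  -- by parts in direction `e`.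
  have hdd (x v) : fderiv ℝ (fun z => fderiv ℝ ψ z e) x v = fderiv ℝ (fderiv ℝ ψ) x e v := by
    have hd : DifferentiableAt ℝ (fderiv ℝ ψ) x :=
      (hψ1.fderiv_right (m := 1) (by norm_cast)).differentiable one_ne_zero x
    rw [fderiv_clm_apply hd (differentiableAt_const e)]
    simpa using ((contDiff_infty.1 hψ1 2).contDiffAt.isSymmSndFDerivAt (by simp)).eq v e
  have hs := hsol _ hψe
  have e1 : ∫ x in Ω, A ‖gradient u x‖ *
      inner ℝ (gradient u x) (gradient (fun z => fderiv ℝ ψ z e) x) =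
      ∫ x, fderiv ℝ (fderiv ℝ ψ) x e (A ‖gradient u x‖ • gradient u x) := by
    rw [setIntegral_eq_integral_of_forall_compl_eq_zero]
    · refine integral_congr_ae (Eventually.of_forall fun x => ?_)
      simp only
      rw [real_inner_comm, inner_gradient_eq_fderiv, hdd, map_smul, smul_eq_mul]
    · intro x hx
      rw [real_inner_comm, inner_gradient_eq_fderiv, hdd0 x hx]
      simp
  have e2 : ∫ x in Ω, B ‖gradient u x‖ * fderiv ℝ ψ x e =
      ∫ x, B ‖gradient u x‖ * fderiv ℝ ψ x e :=
    setIntegral_eq_integral_of_forall_compl_eq_zero fun x hx => by simp [hd0 x hx]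
  have e3 : ∫ x in Ω, f x * fderiv ℝ ψ x e = - ∫ x, Df x i * ψ x := by
    rw [← setIntegral_eq_integral_of_forall_compl_eq_zero (s := Ω)
      (f := fun x => Df x i * ψ x) fun x hx => by simp [h00 x hx], ← hDf.2.2 ψ hψΩ i]
    refine integral_congr_ae (Eventually.of_forall fun x => ?_)
    simp only
    rw [← inner_gradient_eq_fderiv, he, EuclideanSpace.inner_single_right]
    simp
  have iD : Integrable (fun x => Df x i * ψ x) := by
    have h1 : IntegrableOn Df (tsupport ψ) :=
      hDf.2.1.integrableOn_compact_subset hψΩ.2.2 hψ2.isCompact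
    have h2 : IntegrableOn (fun x => Df x i) (tsupport ψ) :=
      (EuclideanSpace.proj (𝕜 := ℝ) i).integrable_comp h1
    have h3 : IntegrableOn (fun x => Df x i * ψ x) (tsupport ψ) :=
      h2.mul_continuousOn hψ1.continuous.continuousOn hψ2.isCompact
    refine (integrableOn_iff_integrable_of_support_subset fun x hx => ?_).1 h3
    by_contra hn
    exact hx (by simp [image_eq_zero_of_notMem_tsupport hn])
  rw [e1, e2, e3, eV, eB] at hs
  have hfin : ∫ x, (fderiv ℝ ψ x (fluxDeriv A (gradient u x) (gradPartial u i x)) +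
      (deriv B ‖gradient u x‖ * (inner ℝ (gradient u x) (gradPartial u i x) / ‖gradient u x‖)
        - Df x i) * ψ x) =
      ∫ x, ((fderiv ℝ ψ x (fderiv ℝ (fun z => A ‖gradient u z‖ • gradient u z) x e) +
        fderiv ℝ (fun z => B ‖gradient u z‖) x e * ψ x) - Df x i * ψ x) := by
    refine integral_congr_ae (Eventually.of_forall fun x => ?_)
    simp only
    by_cases hx : x ∈ tsupport ψ
    · rw [fderiv_flux_gradient hU hu2 h0 hA i (hψ3 hx),
        fderiv_comp_norm_gradient hU hu2 h0 hB i (hψ3 hx)]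
      ring
    · rw [fderiv_of_notMem_tsupport ℝ hx, image_eq_zero_of_notMem_tsupport hx]
      simp
  have h1 := integral_sub (iV.add iB) iD
  have h2 := integral_add iV iB
  simp only [Pi.add_apply] at h1 h2
  rw [hfin, h1, h2]
  linarith

/-- The `i`-th partial derivative of the equation, tested with `φ ∈ C_c^1(Ω ∖ Z_u)`. -/
theorem linearized (hΩ : IsOpen Ω) (hA : ContDiffOn ℝ 1 A (Ioi 0))
    (hB : ContDiffOn ℝ 1 B (Ici 0)) (hDf : IsWeakGradient Ω f Df) (hu1 : ContDiffOn ℝ 1 u Ω)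
    (hu2 : ContDiffOn ℝ 2 u (Ω \ critSet Ω u)) (hsol : IsWeakSolution Ω A B f u) (i : Fin N)
    {φ : EucSp N → ℝ} (hφ : ContDiff ℝ 1 φ) (hc : HasCompactSupport φ)
    (hs : tsupport φ ⊆ Ω \ critSet Ω u) :
    Integrable (fun x => fderiv ℝ φ x (fluxDeriv A (gradient u x) (gradPartial u i x)) +
      (deriv B ‖gradient u x‖ * (inner ℝ (gradient u x) (gradPartial u i x) / ‖gradient u x‖)
        - Df x i) * φ x) ∧
    ∫ x, (fderiv ℝ φ x (fluxDeriv A (gradient u x) (gradPartial u i x)) +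
      (deriv B ‖gradient u x‖ * (inner ℝ (gradient u x) (gradPartial u i x) / ‖gradient u x‖)
        - Df x i) * φ x) = 0 := by
  have hU : IsOpen (Ω \ critSet Ω u) := isOpen_diff_critSet hΩ hu1
  have h0 : ∀ x ∈ Ω \ critSet Ω u, gradient u x ≠ 0 := fun x hx h => hx.2 ⟨hx.1, h⟩
  have hVU : ContDiffOn ℝ 1 (fun z => A ‖gradient u z‖ • gradient u z) (Ω \ critSet Ω u) :=
    (contDiffOn_norm_gradient_comp hU hu2 h0 Subset.rfl hA).smul (contDiffOn_gradient hU hu2)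
  have hBU : ContDiffOn ℝ 1 (fun z => B ‖gradient u z‖) (Ω \ critSet Ω u) :=
    contDiffOn_norm_gradient_comp hU hu2 h0 Ioi_subset_Ici_self hB
  have hWc : ContinuousOn (fun x => fluxDeriv A (gradient u x) (gradPartial u i x))
      (Ω \ critSet Ω u) :=
    ((hVU.continuousOn_fderiv_of_isOpen hU le_rfl).clm_apply continuousOn_const).congr
      fun x hx => (fderiv_flux_gradient hU hu2 h0 hA i hx).symm
  have hwc : ContinuousOn (fun x => deriv B ‖gradient u x‖ *
      (inner ℝ (gradient u x) (gradPartial u i x) / ‖gradient u x‖)) (Ω \ critSet Ω u) :=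
    ((hBU.continuousOn_fderiv_of_isOpen hU le_rfl).clm_apply continuousOn_const).congr
      fun x hx => (fderiv_comp_norm_gradient hU hu2 h0 hB i hx).symm
  refine integrable_and_integral_eq_zero_of_forall_isTestFunction hU (hWc.locallyIntegrableOn hU.measurableSet)
    ((hwc.locallyIntegrableOn hU.measurableSet).sub ?_)
    (fun ψ hψ => linearized_of_isTestFunction hΩ hA hB hDf hu1 hu2 hsol i hψ) hφ hc hs
  have h1 : LocallyIntegrableOn Df (Ω \ critSet Ω u) := hDf.2.1.mono_set sdiff_subset
  intro x hx
  obtain ⟨s, hs, hi⟩ := h1 x hx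
  exact ⟨s, hs, (EuclideanSpace.proj (𝕜 := ℝ) i).integrable_comp hi⟩

end Linearized

/-! ### Truncated powers -/

section Truncation

/-- A smooth truncation of `|t|^(-β)` vanishing for `t² ≤ κ`. -/
noncomputable def truncPow (β κ t : ℝ) : ℝ :=
  (t ^ 2 + κ) ^ (-(β / 2)) * Real.smoothTransition (t ^ 2 / κ - 1)

variable {β κ : ℝ}

theorem truncPow_nonneg (hκ : 0 < κ) (t : ℝ) : 0 ≤ truncPow β κ t :=
  mul_nonneg (Real.rpow_nonneg (by positivity) _) (Real.smoothTransition.nonneg _)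

theorem truncPow_eq_zero (hκ : 0 < κ) {t : ℝ} (ht : t ^ 2 ≤ κ) : truncPow β κ t = 0 := by
  rw [truncPow, Real.smoothTransition.zero_of_nonpos, mul_zero]
  rw [sub_nonpos, div_le_one hκ]
  exact ht

theorem contDiff_truncPow (hκ : 0 < κ) : ContDiff ℝ 1 (truncPow β κ) := by
  have h1 : ContDiff ℝ 1 fun t : ℝ => (t ^ 2 + κ) ^ (-(β / 2)) :=
    ((contDiff_id.pow 2).add contDiff_const).rpow_const_of_ne fun t => by
      simp only [id]
      positivity
  exact h1.mul (Real.smoothTransition.contDiff.comp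
    (((contDiff_id.pow 2).div_const κ).sub contDiff_const))

theorem sq_rpow_neg_half {t : ℝ} (β : ℝ) : (t ^ 2) ^ (-(β / 2)) = |t| ^ (-β) := by
  rw [← sq_abs, ← Real.rpow_natCast, ← Real.rpow_mul (abs_nonneg t)]
  congr 1
  push_cast
  ring

theorem abs_mul_truncPow_le (hβ₀ : 0 ≤ β) (hβ₁ : β < 1) (hκ : 0 < κ) (t : ℝ) :
    |t| * truncPow β κ t ≤ |t| ^ (1 - β) := by
  rcases eq_or_ne t 0 with rfl | ht
  · simp [Real.zero_rpow (sub_pos.2 hβ₁).ne']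
  have h1 : truncPow β κ t ≤ |t| ^ (-β) := by
    rw [← sq_rpow_neg_half]
    refine (mul_le_of_le_one_right (Real.rpow_nonneg (by positivity) _)
      (Real.smoothTransition.le_one _)).trans ?_
    exact Real.rpow_le_rpow_of_nonpos (by positivity) (by linarith) (by linarith)
  have ht' : 0 < |t| := abs_pos.2 ht
  calc |t| * truncPow β κ t ≤ |t| * |t| ^ (-β) := mul_le_mul_of_nonneg_left h1 ht'.le
    _ = |t| ^ (1 - β) := by rw [sub_eq_add_neg, Real.rpow_add ht', Real.rpow_one]

/-- The power factor contributes `1 - β t²/(t² + κ) ≥ 1 - β`. The cutoff is nondecreasing in `t²`,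
so its derivative enters with a factor `t²` and a good sign. -/
theorem le_deriv_mul_truncPow (hβ₀ : 0 ≤ β) (hκ : 0 < κ) (t : ℝ) :
    (1 - β) * truncPow β κ t ≤ deriv (fun s => s * truncPow β κ s) t := by
  have hp : 0 < t ^ 2 + κ := by positivity
  have h1 : HasDerivAt (fun s : ℝ => s ^ 2 + κ) (2 * t) t := by
    simpa using (hasDerivAt_pow 2 t).add_const κ
  have h2 := h1.rpow_const (p := -(β / 2)) (Or.inl hp.ne')
  have h3 : HasDerivAt (fun s : ℝ => s ^ 2 / κ - 1) (2 * t / κ) t := by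
    simpa using ((hasDerivAt_pow 2 t).div_const κ).sub_const 1
  have h4 : HasDerivAt Real.smoothTransition (deriv Real.smoothTransition (t ^ 2 / κ - 1))
      (t ^ 2 / κ - 1) :=
    ((Real.smoothTransition.contDiff (n := 1)).differentiable one_ne_zero _).hasDerivAt
  have h5 : HasDerivAt (fun s : ℝ => Real.smoothTransition (s ^ 2 / κ - 1))
      (deriv Real.smoothTransition (t ^ 2 / κ - 1) * (2 * t / κ)) t :=
    HasDerivAt.comp (h₂ := Real.smoothTransition) (h := fun s : ℝ => s ^ 2 / κ - 1) t h4 h3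
  have h6 : HasDerivAt (fun s => s * truncPow β κ s) _ t := (hasDerivAt_id t).mul (h2.mul h5)
  have hχ' : 0 ≤ deriv Real.smoothTransition (t ^ 2 / κ - 1) :=
    Real.smoothTransition.monotone.deriv_nonneg
  have hχ := Real.smoothTransition.nonneg (t ^ 2 / κ - 1)
  rw [h6.deriv]
  simp only [truncPow, id]
  set P := (t ^ 2 + κ) ^ (-(β / 2)) with hP
  have hP0 : 0 ≤ P := Real.rpow_nonneg hp.le _
  have hP1 : (t ^ 2 + κ) ^ (-(β / 2) - 1) = P / (t ^ 2 + κ) := by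
    rw [Real.rpow_sub_one hp.ne']
  rw [hP1]
  set X := Real.smoothTransition (t ^ 2 / κ - 1)
  set X' := deriv Real.smoothTransition (t ^ 2 / κ - 1)
  have e1 : t ^ 2 * (P / (t ^ 2 + κ)) ≤ P := by
    rw [← mul_div_assoc, div_le_iff₀ hp]
    nlinarith
  have e2 : 0 ≤ t ^ 2 * (P * (X' * (2 / κ))) := by positivity
  have e3 := mul_le_mul_of_nonneg_left e1 (mul_nonneg hβ₀ hχ)
  have e4 : 1 * (P * X) + t * (2 * t * -(β / 2) * (P / (t ^ 2 + κ)) * X + P * (X' * (2 * t / κ)))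
      = P * X - β * X * (t ^ 2 * (P / (t ^ 2 + κ))) + t ^ 2 * (P * (X' * (2 / κ))) := by
    ring
  rw [e4]
  linarith

theorem tendsto_truncPow {κ : ℕ → ℝ} (hκ : ∀ n, 0 < κ n) (hκ0 : Tendsto κ atTop (𝓝 0)) {t : ℝ}
    (ht : t ≠ 0) : Tendsto (fun n => truncPow β (κ n) t) atTop (𝓝 (|t| ^ (-β))) := by
  have ht2 : 0 < t ^ 2 := by positivity
  have h1 : Tendsto (fun n => (t ^ 2 + κ n) ^ (-(β / 2))) atTop (𝓝 (|t| ^ (-β))) := by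
    rw [← sq_rpow_neg_half]
    refine Tendsto.rpow_const ?_ (Or.inl ht2.ne')
    simpa using hκ0.const_add (t ^ 2)
  refine h1.congr' ?_
  -- Once `2κ ≤ t²` the cutoff factor equals `1`.
  filter_upwards [hκ0.eventually (gt_mem_nhds (half_pos ht2))] with n hn
  rw [truncPow, Real.smoothTransition.one_of_one_le, mul_one]
  rw [le_sub_iff_add_le, le_div_iff₀ (hκ n)]
  linarith

end Truncation

/-! ### Ellipticity and absorption -/

section Flux

variable {N : ℕ} {A : ℝ → ℝ} {m M : ℝ} {G h : EucSp N}

/-- The form is `A (|h|² + (tA'/A) q)` at `t = |G|`, with `q` the squared component of `h` along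
`G`, so `0 ≤ q ≤ |h|²`. For `m ≥ 0` the second term is dropped; for `m < 0` the worst case is `q =
|h|²`. -/
theorem le_inner_fluxDeriv (hG : G ≠ 0) (hA : 0 < A ‖G‖) (hm : m ≤ ‖G‖ * deriv A ‖G‖ / A ‖G‖) :
    min 1 (1 + m) * (A ‖G‖ * ‖h‖ ^ 2) ≤ inner ℝ h (fluxDeriv A G h) := by
  have hg : 0 < ‖G‖ := norm_pos_iff.2 hG
  have hq : (inner ℝ G h / ‖G‖) ^ 2 ≤ ‖h‖ ^ 2 := by
    rw [div_pow, div_le_iff₀ (by positivity), ← mul_pow, ← sq_abs]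
    exact pow_le_pow_left₀ (abs_nonneg _)
      ((abs_real_inner_le_norm G h).trans_eq (mul_comm _ _)) 2
  have e : inner ℝ h (fluxDeriv A G h) = A ‖G‖ * ‖h‖ ^ 2 +
      (‖G‖ * deriv A ‖G‖ / A ‖G‖) * (A ‖G‖ * (inner ℝ G h / ‖G‖) ^ 2) := by
    rw [fluxDeriv, inner_add_right, inner_smul_right, inner_smul_right,
      real_inner_self_eq_norm_sq, real_inner_comm h G]
    field_simp
  rw [e]
  set q := (inner ℝ G h / ‖G‖) ^ 2
  have hq0 : 0 ≤ A ‖G‖ * q := mul_nonneg hA.le (sq_nonneg _)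
  have h1 := mul_le_mul_of_nonneg_right hm hq0
  have h2 := mul_le_mul_of_nonneg_left hq hA.le
  rcases le_total 0 m with h0 | h0
  · rw [min_eq_left (by linarith)]
    nlinarith [mul_nonneg h0 hq0]
  · rw [min_eq_right (by linarith)]
    nlinarith [mul_le_mul_of_nonpos_left h2 h0]

theorem norm_fluxDeriv_le (hG : G ≠ 0) (hA : 0 < A ‖G‖) (hm : m ≤ ‖G‖ * deriv A ‖G‖ / A ‖G‖)
    (hM : ‖G‖ * deriv A ‖G‖ / A ‖G‖ ≤ M) :
    ‖fluxDeriv A G h‖ ≤ (1 + max |m| |M|) * (A ‖G‖ * ‖h‖) := by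
  have hg : 0 < ‖G‖ := norm_pos_iff.2 hG
  have hΛ : |‖G‖ * deriv A ‖G‖ / A ‖G‖| ≤ max |m| |M| :=
    abs_le_max_abs_abs hm hM
  have hq : |inner ℝ G h / ‖G‖| ≤ ‖h‖ := by
    rw [abs_div, abs_norm, div_le_iff₀ hg]
    exact (abs_real_inner_le_norm G h).trans_eq (mul_comm _ _)
  rw [fluxDeriv, add_mul, one_mul]
  refine (norm_add_le _ _).trans (add_le_add ?_ ?_)
  · rw [norm_smul, Real.norm_of_nonneg hA.le]
  · have e : ‖(deriv A ‖G‖ * (inner ℝ G h / ‖G‖)) • G‖ =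
        |‖G‖ * deriv A ‖G‖ / A ‖G‖| * (A ‖G‖ * |inner ℝ G h / ‖G‖|) := by
      rw [norm_smul, Real.norm_eq_abs, abs_mul, abs_div (_ * _) (A ‖G‖), abs_mul, abs_norm,
        abs_of_pos hA]
      field_simp
    rw [e]
    exact mul_le_mul hΛ (mul_le_mul_of_nonneg_left hq hA.le) (by positivity)
      ((abs_nonneg _).trans (le_max_left _ _))

/-- Absorption of the lower order terms, by Young's inequality. -/
theorem young_absorption {k a s t τ z d g Λ Chat F L P Q E₁ E₂ E₃ : ℝ} (hk : 0 < k) (ha : 0 ≤ a)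
    (hτ : 0 ≤ τ) (hg : 0 ≤ g) (hgL : g ≤ L)
    (hP : a * t ^ 2 * τ ≤ P) (hQ : |t| * τ ≤ Q)
    (h₁ : k * (a * s ^ 2 * τ * z ^ 2) ≤ E₁)
    (h₂ : |E₂| ≤ 2 * Λ * (a * s) * d * |t| * τ * |z|)
    (h₃ : |E₃| ≤ (Chat * g * a * s + F) * (|t| * τ) * z ^ 2) (hF : 0 ≤ F) :
    k / 2 * (a * s ^ 2 * τ * z ^ 2) -
      (4 * Λ ^ 2 / k * P + Chat ^ 2 * L ^ 2 / k * P + F * Q) * (z ^ 2 + d ^ 2) ≤ E₁ + E₂ + E₃ := by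
  have hP0 : 0 ≤ P := le_trans (by positivity) hP
  have hQ0 : 0 ≤ Q := le_trans (by positivity) hQ
  -- In the application `a = A(|∇u|)`, `s = |∇u_i|`, `t = u_i`, `z = ζ`, `d = |∇ζ|`, `g = |∇u|`.
  -- Each of the two cross terms consumes a quarter of the coercive term, leaving `k / 2`; what
  -- remains carries the factor `a t² τ ≤ P`.
  have y₁ : 2 * Λ * (a * s) * d * |t| * τ * |z| ≤
      k / 4 * (a * s ^ 2 * τ * z ^ 2) + 4 * Λ ^ 2 / k * (a * t ^ 2 * τ) * d ^ 2 := by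
    have h : 0 ≤ a * τ * (k / 2 * (s * |z|) - 2 * Λ * |t| * d) ^ 2 / k := by positivity
    have e : a * τ * (k / 2 * (s * |z|) - 2 * Λ * |t| * d) ^ 2 / k =
        k / 4 * (a * s ^ 2 * τ * |z| ^ 2) + 4 * Λ ^ 2 / k * (a * |t| ^ 2 * τ) * d ^ 2 -
        2 * Λ * (a * s) * d * |t| * τ * |z| := by
      field_simp
      ring
    rw [sq_abs, sq_abs] at e
    linarith
  have y₂ : Chat * g * a * s * (|t| * τ) * z ^ 2 ≤
      k / 4 * (a * s ^ 2 * τ * z ^ 2) + Chat ^ 2 * g ^ 2 / k * (a * t ^ 2 * τ) * z ^ 2 := by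
    have h : 0 ≤ a * τ * z ^ 2 * (k / 2 * s - Chat * g * |t|) ^ 2 / k := by positivity
    have e : a * τ * z ^ 2 * (k / 2 * s - Chat * g * |t|) ^ 2 / k =
        k / 4 * (a * s ^ 2 * τ * z ^ 2) + Chat ^ 2 * g ^ 2 / k * (a * |t| ^ 2 * τ) * z ^ 2 -
        Chat * g * a * s * (|t| * τ) * z ^ 2 := by
      field_simp
      ring
    rw [sq_abs] at e
    linarith
  have b₁ : 4 * Λ ^ 2 / k * (a * t ^ 2 * τ) * d ^ 2 ≤ 4 * Λ ^ 2 / k * P * d ^ 2 := by gcongr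
  have b₂ : Chat ^ 2 * g ^ 2 / k * (a * t ^ 2 * τ) * z ^ 2 ≤ Chat ^ 2 * L ^ 2 / k * P * z ^ 2 := by
    gcongr
  have b₃ : F * (|t| * τ) * z ^ 2 ≤ F * Q * z ^ 2 := by gcongr
  have c₁ : 0 ≤ 4 * Λ ^ 2 / k * P * z ^ 2 := by positivity
  have c₂ : 0 ≤ Chat ^ 2 * L ^ 2 / k * P * d ^ 2 := by positivity
  have c₃ : 0 ≤ F * Q * d ^ 2 := by positivity
  have l₂ := neg_abs_le E₂
  have l₃ := neg_abs_le E₃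
  nlinarith

end Flux

/-! ### The energy estimate -/

section Energy

variable {N : ℕ} {Ω : Set (EucSp N)} {A B : ℝ → ℝ} {f u : EucSp N → ℝ} {Df : EucSp N → EucSp N}

/-- The constant in the energy estimate. -/
noncomputable def energyConst (β m M Chat T L F : ℝ) : ℝ :=
  4 * (1 + max |m| |M|) ^ 2 / (min 1 (1 + m) * (1 - β)) * (|T| * |L| ^ (1 - β)) +
    Chat ^ 2 * L ^ 2 / (min 1 (1 + m) * (1 - β)) * (|T| * |L| ^ (1 - β)) + |F| * |L| ^ (1 - β)

theorem energyConst_nonneg {β m M Chat T L F : ℝ} (hβ₁ : β < 1) (hm : -1 < m) :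
    0 ≤ energyConst β m M Chat T L F := by
  have h1 : 0 < min 1 (1 + m) := lt_min one_pos (by linarith)
  have h2 : 0 < 1 - β := by linarith
  unfold energyConst
  positivity

/-- The energy estimate for the derivatives of the solution, with a smooth cutoff `ζ` and the
truncation at level `κ`. -/
theorem energy_estimate {β m M Chat T L F κ : ℝ} {D : Set (EucSp N)}
    (hβ₀ : 0 ≤ β) (hβ₁ : β < 1) (hm : -1 < m) (hκ : 0 < κ)
    (hΩ : IsOpen Ω) (hA : ContDiffOn ℝ 1 A (Ioi 0)) (hA0 : ∀ t, 0 < t → 0 < A t)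
    (hAm : ∀ t, 0 < t → m ≤ t * deriv A t / A t) (hAM : ∀ t, 0 < t → t * deriv A t / A t ≤ M)
    (hT : ∀ t, 0 < t → t ≤ L → t * A t ≤ T)
    (hB : ContDiffOn ℝ 1 B (Ici 0)) (hB' : ∀ t, 0 < t → |deriv B t| ≤ Chat * (t * A t))
    (hDf : IsWeakGradient Ω f Df) (hD : D ⊆ Ω)
    (hF : ∀ᵐ x ∂volume, x ∈ D → ‖Df x‖ ≤ F) (hu1 : ContDiffOn ℝ 1 u Ω)
    (hu2 : ContDiffOn ℝ 2 u (Ω \ critSet Ω u)) (hsol : IsWeakSolution Ω A B f u)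
    (hL : ∀ x ∈ D, ‖gradient u x‖ ≤ L) (i : Fin N)
    {ζ : EucSp N → ℝ} (hζ : ContDiff ℝ 1 ζ) (hζc : HasCompactSupport ζ) (hζD : tsupport ζ ⊆ D) :
    Integrable (fun x => A ‖gradient u x‖ * ‖gradPartial u i x‖ ^ 2 *
      truncPow β κ (gradient u x i) * ζ x ^ 2) ∧
    min 1 (1 + m) * (1 - β) / 2 * ∫ x, A ‖gradient u x‖ * ‖gradPartial u i x‖ ^ 2 *
      truncPow β κ (gradient u x i) * ζ x ^ 2 ≤
      energyConst β m M Chat T L F * ∫ x, (ζ x ^ 2 + ‖fderiv ℝ ζ x‖ ^ 2) := by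
  have hU : IsOpen (Ω \ critSet Ω u) := isOpen_diff_critSet hΩ hu1
  have h0 : ∀ x ∈ Ω \ critSet Ω u, gradient u x ≠ 0 := fun x hx h => hx.2 ⟨hx.1, h⟩
  have hGc : ContinuousOn (fun x => gradient u x i) Ω :=
    (EuclideanSpace.proj (𝕜 := ℝ) i).continuous.comp_continuousOn (continuousOn_gradient hΩ hu1)
  -- Outside `K` the test function vanishes. `K` is compact by continuity of `u_i`, and misses `Z_u`
  -- because `u_i² ≥ κ > 0` on it.
  set K : Set (EucSp N) := tsupport ζ ∩ (fun x => gradient u x i) ⁻¹' {t | κ ≤ t ^ 2} with hKdef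
  have hK : IsCompact K := by
    refine hζc.isCompact.of_isClosed_subset ?_ inter_subset_left
    exact (hGc.mono (hζD.trans hD)).preimage_isClosed_of_isClosed (isClosed_tsupport ζ)
      (isClosed_le continuous_const (continuous_pow 2))
  have hKU : K ⊆ Ω \ critSet Ω u := by
    rintro x ⟨hx1, hx2⟩
    refine ⟨hD (hζD hx1), fun hx => ?_⟩
    have hx2' : κ ≤ (gradient u x i) ^ 2 := hx2
    rw [hx.2] at hx2'
    simp at hx2'
    linarith
  have hτ0 (x) (hx : x ∉ K) : truncPow β κ (gradient u x i) * ζ x = 0 := by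
    by_cases hx1 : x ∈ tsupport ζ
    · have : ¬ κ ≤ (gradient u x i) ^ 2 := fun h => hx ⟨hx1, h⟩
      rw [truncPow_eq_zero hκ (not_le.1 this).le, zero_mul]
    · rw [image_eq_zero_of_notMem_tsupport hx1, mul_zero]
  set S : ℝ → ℝ := fun t => t * truncPow β κ t with hS
  have hSc : ContDiff ℝ 1 S := contDiff_id.mul (contDiff_truncPow hκ)
  set φ : EucSp N → ℝ := fun x => S (gradient u x i) * ζ x ^ 2 with hφdef
  have hφ0 (x) (hx : x ∉ K) : φ x = 0 := by
    have : φ x = gradient u x i * (truncPow β κ (gradient u x i) * ζ x) * ζ x := by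
      simp only [hφdef, hS]
      ring
    rw [this, hτ0 x hx]
    simp
  have hφs : tsupport φ ⊆ K := closure_minimal (fun x hx => by
    by_contra hn
    exact hx (hφ0 x hn)) hK.isClosed
  have hφd0 (x) (hx : x ∉ K) : fderiv ℝ φ x = 0 :=
    fderiv_of_notMem_tsupport ℝ fun h => hx (hφs h)
  have hGi : ContDiffOn ℝ 1 (fun x => gradient u x i) (Ω \ critSet Ω u) :=
    (EuclideanSpace.proj (𝕜 := ℝ) i).contDiff.comp_contDiffOn (contDiffOn_gradient hU hu2)
  have hφc : ContDiff ℝ 1 φ := contDiff_iff_contDiffAt.2 fun x => by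
    by_cases hx : x ∈ tsupport φ
    · exact (hSc.contDiffAt.comp x (hGi.contDiffAt (hU.mem_nhds (hKU (hφs hx))))).mul
        (hζ.contDiffAt.pow 2)
    · exact contDiffAt_const.congr_of_eventuallyEq (notMem_tsupport_iff_eventuallyEq.1 hx)
  have hφK : HasCompactSupport φ := hK.of_isClosed_subset (isClosed_tsupport φ) hφs
  obtain ⟨hEi, hE0⟩ := linearized hΩ hA hB hDf hu1 hu2 hsol i hφc hφK (hφs.trans hKU)
  have hX : Integrable (fun x => A ‖gradient u x‖ * ‖gradPartial u i x‖ ^ 2 *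
      truncPow β κ (gradient u x i) * ζ x ^ 2) := by
    refine integrable_of_continuousOn_of_support_subset hK ?_ fun x hx => ?_
    · have c1 := ((contDiffOn_norm_gradient_comp hU hu2 h0 Subset.rfl hA).continuousOn).mono hKU
      have c2 := (continuousOn_gradPartial hU hu2 h0 i).mono hKU
      exact ((c1.mul (c2.norm.pow 2)).mul ((contDiff_truncPow hκ).continuous.comp_continuousOn
        (hGi.continuousOn.mono hKU))).mul (hζ.continuous.pow 2).continuousOn
    · by_contra hn
      refine hx ?_
      have : A ‖gradient u x‖ * ‖gradPartial u i x‖ ^ 2 *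
        truncPow β κ (gradient u x i) * ζ x ^ 2 = A ‖gradient u x‖ * ‖gradPartial u i x‖ ^ 2 *
        (truncPow β κ (gradient u x i) * ζ x) * ζ x := by ring
      simp only
      rw [this, hτ0 x hn]
      simp
  have hR : Integrable (fun x => ζ x ^ 2 + ‖fderiv ℝ ζ x‖ ^ 2) := by
    have c1 : Continuous (fderiv ℝ ζ) := hζ.continuous_fderiv one_ne_zero
    refine integrable_of_continuousOn_of_support_subset hζc.isCompact
      ((hζ.continuous.pow 2).add (c1.norm.pow 2)).continuousOn fun x hx => ?_
    by_contra hn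
    exact hx (by simp [image_eq_zero_of_notMem_tsupport hn, fderiv_of_notMem_tsupport ℝ hn])
  refine ⟨hX, ?_⟩
  -- The inequality holds pointwise against the integrand of the linearized identity, whose integral
  -- is zero.
  have hmain : ∫ x, (min 1 (1 + m) * (1 - β) / 2 * (A ‖gradient u x‖ * ‖gradPartial u i x‖ ^ 2 *
      truncPow β κ (gradient u x i) * ζ x ^ 2) -
      energyConst β m M Chat T L F * (ζ x ^ 2 + ‖fderiv ℝ ζ x‖ ^ 2)) ≤ 0 := by
    rw [← hE0]
    refine integral_mono_ae ((hX.const_mul _).sub (hR.const_mul _)) hEi ?_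
    filter_upwards [hF] with x hFx
    by_cases hxK : x ∈ K
    · have hxU := hKU hxK
      have hxD : x ∈ D := hζD hxK.1
      have hG := h0 x hxU
      have hg : 0 < ‖gradient u x‖ := norm_pos_iff.2 hG
      have hgL := hL x hxD
      have hL0 : 0 < L := hg.trans_le hgL
      have ha := hA0 _ hg
      have hdS := ((hSc.differentiable one_ne_zero _).hasDerivAt.comp_hasFDerivAt x
        (hasFDerivAt_gradient_apply (hu2.contDiffAt (hU.mem_nhds hxU)) i))
      have hdζ := (hζ.differentiable one_ne_zero x).hasFDerivAt.pow 2
      have hdφ := (hdS.mul hdζ).fderiv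
      rw [← gradPartial_eq (hu2.contDiffAt (hU.mem_nhds hxU)) hG] at hdφ
      have hdφ' (v) : fderiv ℝ φ x v =
          deriv S (gradient u x i) * inner ℝ (gradPartial u i x) v * ζ x ^ 2 +
            2 * ζ x * S (gradient u x i) * fderiv ℝ ζ x v := by
        have : fderiv ℝ φ x v = _ := congrArg (fun l => l v) hdφ
        rw [this]
        simp
        ring
      set h := gradPartial u i x with hh
      set g := ‖gradient u x‖ with hgdef
      set t := gradient u x i with ht
      set τ := truncPow β κ t with hτ
      have htg : |t| ≤ g := abs_gradient_apply_le u x i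
      have hτn : 0 ≤ τ := truncPow_nonneg hκ t
      have hQ : |t| * τ ≤ |L| ^ (1 - β) := by
        refine (abs_mul_truncPow_le hβ₀ hβ₁ hκ t).trans ?_
        exact Real.rpow_le_rpow (abs_nonneg t) (htg.trans (hgL.trans (le_abs_self L)))
          (by linarith)
      -- One factor `|u_i| ≤ |∇u|` is spent on `t A(t) ≤ T`, the other on the singular weight; the
      -- bound is free of `κ`.
      have hP : A g * t ^ 2 * τ ≤ |T| * |L| ^ (1 - β) := by
        have e : A g * t ^ 2 * τ = (A g * |t|) * (|t| * τ) := by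
          rw [← sq_abs]
          ring
        rw [e]
        refine mul_le_mul ?_ hQ (by positivity) (abs_nonneg T)
        calc A g * |t| ≤ A g * g := mul_le_mul_of_nonneg_left htg ha.le
          _ = g * A g := mul_comm _ _
          _ ≤ T := hT g hg hgL
          _ ≤ |T| := le_abs_self T
      have hk : 0 < min 1 (1 + m) := lt_min one_pos (by linarith)
      have hF0 : ‖Df x‖ ≤ |F| := (hFx hxD).trans (le_abs_self F)
      have hin := le_inner_fluxDeriv (h := h) hG ha (hAm _ hg)
      have hWn := norm_fluxDeriv_le (h := h) hG ha (hAm _ hg) (hAM _ hg)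
      set W := fluxDeriv A (gradient u x) h with hW
      have hin0 : 0 ≤ min 1 (1 + m) * (A g * ‖h‖ ^ 2) := by positivity
      have key := young_absorption (k := min 1 (1 + m) * (1 - β)) (a := A g) (s := ‖h‖) (t := t)
        (τ := τ) (z := ζ x) (d := ‖fderiv ℝ ζ x‖) (g := g) (Λ := 1 + max |m| |M|) (Chat := Chat)
        (F := |F|) (L := L) (P := |T| * |L| ^ (1 - β)) (Q := |L| ^ (1 - β))
        (E₁ := deriv S t * inner ℝ h W * ζ x ^ 2)
        (E₂ := 2 * ζ x * S t * fderiv ℝ ζ x W)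
        (E₃ := (deriv B g * (inner ℝ (gradient u x) h / g) - Df x i) * φ x)
        (mul_pos hk (by linarith)) ha.le hτn hg.le hgL hP hQ ?_ ?_ ?_ (abs_nonneg F)
      · rw [hdφ']
        refine le_trans (le_of_eq ?_) key
        rw [energyConst]
      · have h1 := le_deriv_mul_truncPow hβ₀ hκ t
        have h2 : (1 - β) * τ * (min 1 (1 + m) * (A g * ‖h‖ ^ 2)) ≤ deriv S t * inner ℝ h W :=
          mul_le_mul h1 hin hin0 (le_trans (mul_nonneg (by linarith) hτn) h1)
        have h3 := mul_le_mul_of_nonneg_right h2 (sq_nonneg (ζ x))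
        refine le_trans (le_of_eq ?_) h3
        ring
      · have h1 : |fderiv ℝ ζ x W| ≤ ‖fderiv ℝ ζ x‖ * ((1 + max |m| |M|) * (A g * ‖h‖)) :=
          ((fderiv ℝ ζ x).le_opNorm W).trans (mul_le_mul_of_nonneg_left hWn (norm_nonneg _))
        have h2 : |2 * ζ x * S t * fderiv ℝ ζ x W| =
            2 * |ζ x| * (|t| * τ) * |fderiv ℝ ζ x W| := by
          simp only [hS, abs_mul, abs_two, abs_of_nonneg hτn, ← hτ]
        rw [h2]
        refine (mul_le_mul_of_nonneg_left h1 (by positivity)).trans (le_of_eq ?_)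
        ring
      · have h1 : |inner ℝ (gradient u x) h / g| ≤ ‖h‖ := by
          rw [abs_div, abs_of_pos hg, div_le_iff₀ hg]
          exact (abs_real_inner_le_norm _ h).trans_eq (mul_comm _ _)
        have h2 : |deriv B g * (inner ℝ (gradient u x) h / g) - Df x i| ≤
            Chat * g * A g * ‖h‖ + |F| := by
          refine (abs_sub _ _).trans (add_le_add ?_ ?_)
          · rw [abs_mul]
            have hb := hB' g hg
            refine (mul_le_mul hb h1 (abs_nonneg _) ((abs_nonneg _).trans hb)).trans
              (le_of_eq ?_)
            ring
          · exact (PiLp.norm_apply_le (Df x) i).trans hF0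
        have h3 : |φ x| = |t| * τ * ζ x ^ 2 := by
          simp only [hφdef, hS, ← ht, ← hτ, abs_mul, abs_of_nonneg hτn, abs_pow, sq_abs]
        rw [abs_mul, h3, ← mul_assoc]
        exact mul_le_mul_of_nonneg_right
          (mul_le_mul_of_nonneg_right h2 (by positivity)) (sq_nonneg _)
    · have h1 : A ‖gradient u x‖ * ‖gradPartial u i x‖ ^ 2 *
        truncPow β κ (gradient u x i) * ζ x ^ 2 = A ‖gradient u x‖ * ‖gradPartial u i x‖ ^ 2 *
        (truncPow β κ (gradient u x i) * ζ x) * ζ x := by ring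
      rw [h1, hτ0 x hxK, hφ0 x hxK, hφd0 x hxK]
      have := mul_nonneg (energyConst_nonneg (M := M) (Chat := Chat) (T := T) (L := L) (F := F)
        hβ₁ hm) (add_nonneg (sq_nonneg (ζ x)) (sq_nonneg ‖fderiv ℝ ζ x‖))
      simpa using this
  rw [integral_sub (hX.const_mul _) (hR.const_mul _), integral_const_mul,
    integral_const_mul] at hmain
  linarith

end Energy

/-! ### Singular weights and cutoffs -/

section Weight

variable {N : ℕ}

theorem integrableOn_ball_norm_rpow_neg (hN : 2 ≤ N) {a : ℝ} (ha : a < N) (r : ℝ) :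
    IntegrableOn (fun x : EucSp N => ‖x‖ ^ (-a)) (Metric.ball 0 r) := by
  refine integrableOn_ball_of_norm_le_rpow (C := 1) (α := a) ?_ ?_ ?_ ?_
  · rw [finrank_euclideanSpace_fin]
    omega
  · rwa [finrank_euclideanSpace_fin]
  · refine Eventually.of_forall fun x => ?_
    rw [one_mul, Real.norm_of_nonneg (Real.rpow_nonneg (norm_nonneg x) _)]
  · exact (measurable_norm.pow_const _).aestronglyMeasurable

theorem norm_fderiv_regularized_rpow_le {γ δ : ℝ} (hγ : 0 ≤ γ) (hδ : 0 < δ) (x y : EucSp N) :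
    ‖fderiv ℝ (fun z : EucSp N => (‖z - y‖ ^ 2 + δ) ^ (-(γ / 4))) x‖ ≤
      γ / 2 * (‖x - y‖ * (‖x - y‖ ^ 2 + δ) ^ (-(γ / 4) - 1)) := by
  have hq : 0 < ‖x - y‖ ^ 2 + δ := by positivity
  have h1 := ((((hasFDerivAt_id (𝕜 := ℝ) x).sub_const y).norm_sq).add_const δ).rpow_const
    (p := -(γ / 4)) (Or.inl hq.ne')
  have h2 : fderiv ℝ (fun z : EucSp N => (‖z - y‖ ^ 2 + δ) ^ (-(γ / 4))) x = _ := h1.fderiv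
  rw [h2]
  refine ContinuousLinearMap.opNorm_le_bound _ (by positivity) fun v => ?_
  have hi := abs_real_inner_le_norm (x - y) v
  have hp : 0 ≤ (‖x - y‖ ^ 2 + δ) ^ (-(γ / 4) - 1) := Real.rpow_nonneg hq.le _
  simp only [id, smul_apply, ContinuousLinearMap.comp_id, innerSL_apply_apply, smul_eq_mul,
    nsmul_eq_mul, Real.norm_eq_abs, abs_mul, abs_neg, Nat.cast_ofNat, abs_two, abs_of_nonneg hp,
    abs_of_nonneg (div_nonneg hγ zero_le_four)]
  calc γ / 4 * (‖x - y‖ ^ 2 + δ) ^ (-(γ / 4) - 1) * (2 * |inner ℝ (x - y) v|)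
      ≤ γ / 4 * (‖x - y‖ ^ 2 + δ) ^ (-(γ / 4) - 1) * (2 * (‖x - y‖ * ‖v‖)) := by gcongr
    _ = γ / 2 * (‖x - y‖ * (‖x - y‖ ^ 2 + δ) ^ (-(γ / 4) - 1)) * ‖v‖ := by ring

/-- Cutoff functions for the weight `|x - y|^(-γ)`, with bounds uniform in `y` and in the
regularization parameter `δ`. -/
theorem exists_weighted_cutoff (hN : 2 ≤ N) {γ : ℝ} (hγ₀ : 0 ≤ γ)
    (hγ : γ = 0 ∨ γ < (N : ℝ) - 2) (x₀ : EucSp N) {ρ : ℝ} (hρ : 0 < ρ) :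
    ∃ K : ℝ, ∀ y ∈ Metric.ball x₀ ρ, ∀ δ : ℝ, 0 < δ → ∃ ζ : EucSp N → ℝ,
      ContDiff ℝ 1 ζ ∧ HasCompactSupport ζ ∧ tsupport ζ ⊆ Metric.ball x₀ (2 * ρ) ∧
      (∀ x ∈ Metric.ball x₀ ρ, ζ x ^ 2 = (‖x - y‖ ^ 2 + δ) ^ (-(γ / 2))) ∧
      ∫ x, (ζ x ^ 2 + ‖fderiv ℝ ζ x‖ ^ 2) ≤ K := by
  let η : ContDiffBump x₀ := ⟨ρ, 3 / 2 * ρ, hρ, by linarith⟩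
  have hηc : ContDiff ℝ 1 η := η.contDiff
  obtain ⟨c, hc⟩ := (η.hasCompactSupport.fderiv (𝕜 := ℝ)).exists_bound_of_continuous
    (hηc.continuous_fderiv one_ne_zero)
  have hηs : tsupport η ⊆ Metric.ball x₀ (2 * ρ) := by
    rw [η.tsupport_eq]
    exact Metric.closedBall_subset_ball (by simp only [η]; linarith)
  -- A majorant of `ζ² + |∇ζ|²` in the variable `z = x - y`. The more singular term is integrable
  -- since `γ + 2 < N`, or has coefficient `0` when `γ = 0`.
  let Φ : EucSp N → ℝ := fun z =>
    (1 + 2 * c ^ 2) * ‖z‖ ^ (-γ) + γ ^ 2 / 2 * ‖z‖ ^ (-(γ + 2))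
  have hN2 : (2 : ℝ) ≤ N := by exact_mod_cast hN
  have hΦ : IntegrableOn Φ (Metric.ball 0 (3 * ρ)) := by
    refine Integrable.add
      ((integrableOn_ball_norm_rpow_neg hN (by rcases hγ with h | h <;> linarith) _).const_mul _) ?_
    rcases hγ with h | h
    · simp [h]
    · exact (integrableOn_ball_norm_rpow_neg hN (by linarith) _).const_mul _
  have hΦ' := hΦ.integrable_indicator Metric.isOpen_ball.measurableSet
  -- Translation by `y` makes the bound independent of `y`. The radius is `3ρ` since `|x - x₀| < 2ρ`
  -- on the support and `|y - x₀| < ρ`.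
  refine ⟨∫ z, (Metric.ball (0 : EucSp N) (3 * ρ)).indicator Φ z, fun y hy δ hδ => ?_⟩
  let p : EucSp N → ℝ := fun z => (‖z - y‖ ^ 2 + δ) ^ (-(γ / 4))
  have hq (x : EucSp N) : 0 < ‖x - y‖ ^ 2 + δ := by positivity
  have hp : ContDiff ℝ 1 p :=
    (((contDiff_id.sub contDiff_const).norm_sq ℝ).add contDiff_const).rpow_const_of_ne
      fun x => (hq x).ne'
  have hp2 (x : EucSp N) : p x ^ 2 = (‖x - y‖ ^ 2 + δ) ^ (-(γ / 2)) := by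
    rw [← Real.rpow_natCast, ← Real.rpow_mul (hq x).le]
    congr 1
    push_cast
    ring
  have hp0 (x : EucSp N) : 0 ≤ p x := Real.rpow_nonneg (hq x).le _
  have hts : tsupport (fun x => p x * η x) ⊆ tsupport η := tsupport_mul_subset_right
  refine ⟨fun x => p x * η x, hp.mul hηc, η.hasCompactSupport.mul_left,
    hts.trans hηs, fun x hx => ?_, ?_⟩
  · simp only
    rw [η.one_of_mem_closedBall (Metric.ball_subset_closedBall hx), mul_one, hp2]
  rw [← integral_sub_right_eq_self ((Metric.ball (0 : EucSp N) (3 * ρ)).indicator Φ) y]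
  refine integral_mono_of_nonneg (Eventually.of_forall fun x => by positivity)
    (hΦ'.comp_sub_right y) ?_
  -- For `γ > 0` the power `‖0‖ ^ (-γ)` has the default value `0`, so the majorant fails at `x = y`.
  have hae : ∀ᵐ x : EucSp N ∂volume, x ≠ y := by
    have : Nontrivial (EucSp N) := by
      have : Nonempty (Fin N) := ⟨⟨0, by omega⟩⟩
      infer_instance
    exact Measure.ae_ne volume y
  filter_upwards [hae] with x hxy
  by_cases hx : x ∈ tsupport η
  · have hxb : x - y ∈ Metric.ball (0 : EucSp N) (3 * ρ) := by
      rw [mem_ball_zero_iff, ← dist_eq_norm]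
      have h1 := Metric.mem_ball.1 (hηs hx)
      have h2 := Metric.mem_ball'.1 hy
      linarith [dist_triangle x x₀ y]
    simp only [indicator_of_mem hxb]
    have hr : 0 < ‖x - y‖ := norm_pos_iff.2 (sub_ne_zero.2 hxy)
    have hη1 : |η x| ≤ 1 := by rw [abs_of_nonneg η.nonneg]; exact η.le_one
    have hmono {a : ℝ} (ha : 0 ≤ a) :
        (‖x - y‖ ^ 2 + δ) ^ (-(a / 2)) ≤ ‖x - y‖ ^ (-a) := by
      have h := sq_rpow_neg_half (t := ‖x - y‖) a
      rw [abs_norm] at h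
      rw [← h]
      exact Real.rpow_le_rpow_of_nonpos (by positivity) (by linarith) (by linarith)
    set q := ‖x - y‖ ^ 2 + δ with hqdef
    have hζ : fderiv ℝ (fun x => p x * η x) x = p x • fderiv ℝ η x + η x • fderiv ℝ p x :=
      ((hp.differentiable one_ne_zero x).hasFDerivAt.mul
        (hηc.differentiable one_ne_zero x).hasFDerivAt).fderiv
    have hn : ‖fderiv ℝ (fun x => p x * η x) x‖ ≤
        p x * c + γ / 2 * (‖x - y‖ * q ^ (-(γ / 4) - 1)) := by
      rw [hζ]
      refine (norm_add_le _ _).trans (add_le_add ?_ ?_)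
      · rw [norm_smul, Real.norm_of_nonneg (hp0 x)]
        exact mul_le_mul_of_nonneg_left (hc x) (hp0 x)
      · rw [norm_smul]
        exact (mul_le_of_le_one_left (norm_nonneg _) hη1).trans
          (norm_fderiv_regularized_rpow_le hγ₀ hδ x y)
    have hn2 : ‖fderiv ℝ (fun x => p x * η x) x‖ ^ 2 ≤
        2 * c ^ 2 * p x ^ 2 + γ ^ 2 / 2 * (‖x - y‖ ^ 2 * (q ^ (-(γ / 4) - 1)) ^ 2) := by
      refine (pow_le_pow_left₀ (norm_nonneg _) hn 2).trans ?_
      nlinarith [sq_nonneg (p x * c - γ / 2 * (‖x - y‖ * q ^ (-(γ / 4) - 1)))]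
    have hq2 : (q ^ (-(γ / 4) - 1)) ^ 2 = q ^ (-((γ + 2) / 2)) / q := by
      rw [← Real.rpow_natCast, ← Real.rpow_mul (hq x).le, ← Real.rpow_sub_one (hq x).ne']
      congr 1
      push_cast
      ring
    -- One factor `1/q` absorbs `|x - y|² ≤ q`; the rest is monotone in `δ`.
    have hr2 : ‖x - y‖ ^ 2 * (q ^ (-(γ / 4) - 1)) ^ 2 ≤ ‖x - y‖ ^ (-(γ + 2)) := by
      rw [hq2, ← mul_div_assoc, div_le_iff₀ (hq x), mul_comm]
      exact mul_le_mul (hmono (by linarith)) (by linarith) (by positivity) (by positivity)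
    have hz2 : (p x * η x) ^ 2 ≤ p x ^ 2 := by
      rw [mul_pow]
      exact mul_le_of_le_one_right (sq_nonneg _) (by
        rw [← sq_abs]
        exact pow_le_one₀ (abs_nonneg _) hη1)
    have hpr : p x ^ 2 ≤ ‖x - y‖ ^ (-γ) := by
      rw [hp2]
      exact hmono hγ₀
    have e1 := mul_le_mul_of_nonneg_left hpr (show 0 ≤ 1 + 2 * c ^ 2 by positivity)
    have e2 := mul_le_mul_of_nonneg_left hr2 (show 0 ≤ γ ^ 2 / 2 by positivity)
    simp only [Φ]
    linarith
  · have hx' : x ∉ tsupport (fun x => p x * η x) := fun h => hx (hts h)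
    have h0 : p x * η x = 0 :=
      image_eq_zero_of_notMem_tsupport (f := fun x => p x * η x) hx'
    simp only [h0, fderiv_of_notMem_tsupport ℝ hx', norm_zero]
    refine le_trans (by simp) (indicator_nonneg (fun z _ => ?_) _)
    simp only [Φ]
    positivity

end Weight

/-! ### Passage to the limit -/

section Main

/-- On `Z_u` this is the convention, elsewhere the almost everywhere statement for each partial
derivative. It matters when `β > 0`: the truncated weight vanishes where `u_i = 0`, while a positive
numerator there would make the integrand infinite. -/
theorem ae_gradPartial_eq_zero {N : ℕ} (u : EucSp N → ℝ) (i : Fin N) :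
    ∀ᵐ x : EucSp N, gradient u x i = 0 → gradPartial u i x = 0 := by
  have hm : Measurable fun z => gradient u z i :=
    (EuclideanSpace.proj (𝕜 := ℝ) i).continuous.measurable.comp (measurable_gradient u)
  have h := ae_all_iff.2 fun j : Fin N =>
    ae_fderiv_eq_zero_of_eq_zero volume hm (EuclideanSpace.single j (1 : ℝ))
  filter_upwards [h] with x hx h0
  rw [gradPartial]
  split_ifs with hG
  · rfl
  · ext j
    have h1 := hx j h0
    rw [← inner_gradient_eq_fderiv, EuclideanSpace.inner_single_right] at h1
    simpa using h1

/-- Reduces a negative `γ` to `γ' = 0`: write `r^(-γ) = r^(γ'-γ) r^(-γ')` and bound the first factor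
by its value at `R`. -/
theorem weighted_integrand_le {a r t γ γ' β R : ℝ} (ha : 0 ≤ a) (hr : 0 < r) (hrR : r ≤ R)
    (ht : t ≠ 0) (hγ : γ ≤ γ') :
    ENNReal.ofReal a / (ENNReal.ofReal r ^ γ * ENNReal.ofReal |t| ^ β) ≤
      ENNReal.ofReal (R ^ (γ' - γ)) * ENNReal.ofReal (a * |t| ^ (-β) * r ^ (-γ')) := by
  have ht' : 0 < |t| := abs_pos.2 ht
  have h1 : 0 < r ^ γ := Real.rpow_pos_of_pos hr _
  have h2 : 0 < |t| ^ β := Real.rpow_pos_of_pos ht' _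
  rw [ENNReal.ofReal_rpow_of_pos hr, ENNReal.ofReal_rpow_of_pos ht', ← ENNReal.ofReal_mul h1.le,
    ← ENNReal.ofReal_div_of_pos (mul_pos h1 h2),
    ← ENNReal.ofReal_mul (Real.rpow_nonneg (hr.le.trans hrR) _)]
  refine ENNReal.ofReal_le_ofReal ?_
  have e : a / (r ^ γ * |t| ^ β) = r ^ (γ' - γ) * (a * |t| ^ (-β) * r ^ (-γ')) := by
    rw [Real.rpow_sub hr, Real.rpow_neg ht'.le, Real.rpow_neg hr.le]
    have h3 : 0 < r ^ γ' := Real.rpow_pos_of_pos hr _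
    field_simp
  rw [e]
  gcongr

/-- Local weighted estimate for the second derivatives of weak solutions. The constant `C` is chosen
after the numerical data only: it does not depend on `Ω`, `u`, `y`, `i`, and it depends on `A`, `B`,
`f` only through `m = inf tA'/A`, `M = sup tA'/A`, the bound `T` of `tA(t)` on `(0, L]`, the
constant `Chat`, and the bound `F` of `|∇f|`. The integral is taken in `[0, ∞]`, where
`0 / 0 = 0` and `a / 0 = ∞` for `a > 0`. -/
theorem theorem1p1 (N : ℕ) (hN : 2 ≤ N) (γ β m M Chat T L F ρ : ℝ) (x₀ : EucSp N)
    (hγ : (N = 2 ∧ γ = 0) ∨ (3 ≤ N ∧ γ < (N : ℝ) - 2))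
    (hβ₀ : 0 ≤ β) (hβ₁ : β < 1) (hm : -1 < m) (hChat : 0 < Chat) (hρ : 0 < ρ) :
    ∃ C : ℝ≥0, ∀ (Ω : Set (EucSp N)) (A B : ℝ → ℝ) (f u : EucSp N → ℝ)
        (Df : EucSp N → EucSp N) (α : ℝ≥0),
      IsOpen Ω → Metric.ball x₀ (2 * ρ) ⊆ Ω →
      -- `A : (0, ∞) → (0, ∞)` of class `C¹`, and the two structural assumptions on `A`
      ContDiffOn ℝ 1 A (Ioi 0) → (∀ t, 0 < t → 0 < A t) →
      limsup (fun t : ℝ => ((t * A t : ℝ) : EReal)) (𝓝[>] 0) < ⊤ →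
      IsGLB ((fun t => t * deriv A t / A t) '' Ioi 0) m →
      IsLUB ((fun t => t * deriv A t / A t) '' Ioi 0) M →
      (∀ t, 0 < t → t ≤ L → t * A t ≤ T) →
      -- `B : [0, ∞) → [0, ∞)` of class `C¹`, and the structural assumption on `B'`
      ContDiffOn ℝ 1 B (Ici 0) → (∀ t, 0 ≤ t → 0 ≤ B t) →
      (∀ t, 0 < t → |deriv B t| ≤ Chat * (t * A t)) →
      -- the source term: `f ∈ W^{1,∞}(Ω)`, with weak gradient `Df`
      MemW1Infty Ω f → IsWeakGradient Ω f Df →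
      (∀ᵐ x ∂(volume.restrict (Metric.ball x₀ (2 * ρ))), ‖Df x‖ ≤ F) →
      -- the solution
      0 < α → α < 1 → MemC1Holder Ω α u → ContDiffOn ℝ 2 u (Ω \ critSet Ω u) →
      IsWeakSolution Ω A B f u →
      (∀ x ∈ Metric.ball x₀ (2 * ρ), ‖gradient u x‖ ≤ L) →
      ∀ y ∈ Metric.ball x₀ ρ, ∀ i : Fin N,
        ∫⁻ x in Metric.ball x₀ ρ,
          ENNReal.ofReal (A ‖gradient u x‖ * ‖gradPartial u i x‖ ^ 2) /
            (ENNReal.ofReal ‖x - y‖ ^ γ * ENNReal.ofReal |gradient u x i| ^ β) ≤ C := by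
  have hN2 : (2 : ℝ) ≤ N := by exact_mod_cast hN
  obtain ⟨K, hK⟩ := exists_weighted_cutoff hN (le_max_right γ 0) (by
    rcases hγ with ⟨-, h⟩ | ⟨h3, h⟩
    · exact Or.inl (by simp [h])
    · refine Or.inr (max_lt h ?_)
      have : (3 : ℝ) ≤ N := by exact_mod_cast h3
      linarith) x₀ hρ
  have hc : 0 < min 1 (1 + m) * (1 - β) / 2 :=
    half_pos (mul_pos (lt_min one_pos (by linarith)) (by linarith))
  -- The first factor is the price of replacing `γ` by `max γ 0`, as `|x - y| ≤ 2ρ`; the second is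
  -- the energy bound divided by the coercivity constant.
  refine ⟨((2 * ρ) ^ (max γ 0 - γ)).toNNReal *
    (energyConst β m M Chat T L F * K / (min 1 (1 + m) * (1 - β) / 2)).toNNReal, ?_⟩
  intro Ω A B f u Df α hΩ hball hA hA0 _ hAm hAM hT hB _ hB' _ hDf hF _ _ hu hu2 hsol hL y hy i
  -- One sequence serves both as truncation level `κ` and as regularization `δ`.
  have hδ (n : ℕ) : (0 : ℝ) < 1 / ((n : ℝ) + 1) := by positivity
  have hδ0 : Tendsto (fun n : ℕ => 1 / ((n : ℝ) + 1)) atTop (𝓝 0) :=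
    tendsto_one_div_add_atTop_nhds_zero_nat
  choose ζ hζ hζc hζs hζw hζK using fun n : ℕ => hK y hy _ (hδ n)
  set H : ℕ → EucSp N → ℝ := fun n x => A ‖gradient u x‖ * ‖gradPartial u i x‖ ^ 2 *
    truncPow β (1 / ((n : ℝ) + 1)) (gradient u x i) * ζ n x ^ 2 with hH
  -- The sign of `A 0` is unknown, but the second factor is `0` on the critical set.
  have ha (x : EucSp N) : 0 ≤ A ‖gradient u x‖ * ‖gradPartial u i x‖ ^ 2 := by
    by_cases hG : gradient u x = 0
    · simp [gradPartial, hG]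
    · exact mul_nonneg (hA0 _ (norm_pos_iff.2 hG)).le (sq_nonneg _)
  have hH0 (n : ℕ) (x : EucSp N) : 0 ≤ H n x :=
    mul_nonneg (mul_nonneg (ha x) (truncPow_nonneg (hδ n) _)) (sq_nonneg _)
  have hest (n : ℕ) := energy_estimate hβ₀ hβ₁ hm (hδ n) hΩ hA hA0
    (fun t ht => hAm.1 (mem_image_of_mem _ ht)) (fun t ht => hAM.1 (mem_image_of_mem _ ht)) hT hB
    hB' hDf hball ((ae_restrict_iff' Metric.isOpen_ball.measurableSet).1 hF) hu.1 hu2 hsol hL i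
    (hζ n) (hζc n) (hζs n)
  have hlint (n : ℕ) : ∫⁻ x in Metric.ball x₀ ρ, ENNReal.ofReal (H n x) ≤
      ENNReal.ofReal (energyConst β m M Chat T L F * K / (min 1 (1 + m) * (1 - β) / 2)) := by
    refine (setLIntegral_le_lintegral _ _).trans ?_
    rw [← ofReal_integral_eq_lintegral_ofReal (hest n).1 (Eventually.of_forall (hH0 n))]
    refine ENNReal.ofReal_le_ofReal ?_
    rw [le_div_iff₀ hc, mul_comm]
    exact (hest n).2.trans (mul_le_mul_of_nonneg_left (hζK n) (energyConst_nonneg hβ₁ hm))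
  have hpt : ∀ᵐ x ∂(volume.restrict (Metric.ball x₀ ρ)),
      ENNReal.ofReal (A ‖gradient u x‖ * ‖gradPartial u i x‖ ^ 2) /
        (ENNReal.ofReal ‖x - y‖ ^ γ * ENNReal.ofReal |gradient u x i| ^ β) ≤
      ENNReal.ofReal ((2 * ρ) ^ (max γ 0 - γ)) *
        liminf (fun n => ENNReal.ofReal (H n x)) atTop := by
    have hae : ∀ᵐ x : EucSp N ∂volume, x ≠ y := by
      have : Nontrivial (EucSp N) := by
        have : Nonempty (Fin N) := ⟨i⟩
        infer_instance
      exact Measure.ae_ne volume y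
    filter_upwards [ae_restrict_of_ae hae, ae_restrict_of_ae (ae_gradPartial_eq_zero u i),
      ae_restrict_mem Metric.isOpen_ball.measurableSet] with x hxy hx0 hxb
    by_cases hz : gradPartial u i x = 0
    · simp [hz]
    have ht : gradient u x i ≠ 0 := fun h => hz (hx0 h)
    have hr : 0 < ‖x - y‖ := norm_pos_iff.2 (sub_ne_zero.2 hxy)
    have hr2 : ‖x - y‖ ≤ 2 * ρ := by
      rw [← dist_eq_norm]
      linarith [dist_triangle x x₀ y, Metric.mem_ball.1 hxb, Metric.mem_ball'.1 hy]
    have hlim : Tendsto (fun n => H n x) atTop (𝓝 (A ‖gradient u x‖ * ‖gradPartial u i x‖ ^ 2 *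
        |gradient u x i| ^ (-β) * ‖x - y‖ ^ (-(max γ 0)))) := by
      refine ((tendsto_truncPow hδ hδ0 ht).const_mul _).mul ?_
      simp_rw [hζw _ x hxb]
      have h := sq_rpow_neg_half (t := ‖x - y‖) (max γ 0)
      rw [abs_norm] at h
      rw [← h]
      refine Tendsto.rpow_const ?_ (Or.inl (by positivity))
      simpa using hδ0.const_add (‖x - y‖ ^ 2)
    rw [(ENNReal.tendsto_ofReal hlim).liminf_eq]
    exact weighted_integrand_le (ha x) hr hr2 ht (le_max_left _ _)
  -- Fatou's lemma: the approximating integrals are bounded uniformly in `n`.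
  calc _ ≤ ∫⁻ x in Metric.ball x₀ ρ, ENNReal.ofReal ((2 * ρ) ^ (max γ 0 - γ)) *
        liminf (fun n => ENNReal.ofReal (H n x)) atTop := lintegral_mono_ae hpt
    _ = ENNReal.ofReal ((2 * ρ) ^ (max γ 0 - γ)) *
        ∫⁻ x in Metric.ball x₀ ρ, liminf (fun n => ENNReal.ofReal (H n x)) atTop :=
      lintegral_const_mul' _ _ ENNReal.ofReal_ne_top
    _ ≤ ENNReal.ofReal ((2 * ρ) ^ (max γ 0 - γ)) *
        liminf (fun n => ∫⁻ x in Metric.ball x₀ ρ, ENNReal.ofReal (H n x)) atTop := by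
      gcongr
      exact lintegral_liminf_le' fun n => (hest n).1.aemeasurable.restrict.ennreal_ofReal
    _ ≤ ENNReal.ofReal ((2 * ρ) ^ (max γ 0 - γ)) *
        ENNReal.ofReal (energyConst β m M Chat T L F * K / (min 1 (1 + m) * (1 - β) / 2)) := by
      gcongr
      exact (liminf_le_liminf (Eventually.of_forall hlint)).trans_eq (liminf_const _)
    _ = _ := by rw [ENNReal.coe_mul]; rfl

end Main
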